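/- **Conventions.** All distributions are probability distributions on $[0,\infty)$; $\overline F(x)=F((x,\infty))$; $F^{*k}$ is the $k$-fold convolution power ($F^{*0}=\delta_0$); all limits are as $x\to\infty$, and membership in any class below includes $\overline F(x)>0$ for all $x$. For $\gamma\ge 0$ put $m(F)=\int_{[0,\infty)}e^{\gamma y}F(dy)\in[0,\infty]$. For distributions that are not lattice (as are all those below), $F\in\mathcal L(\gamma)$ means $\overline F(x-t)/\overline F(x)\to e^{\gamma t}$ for every $t\in\mathbb R$; $F\in\mathcal S(\gamma)$ means $F\in\mathcal L(\gamma)$, $m(F)<\infty$ and $\overline{F^{*2}}(x)/\overline F(x)\to 2m(F)$. Write $\mathcal L=\mathcal L(0)$. Further, $F\in\mathcal{OL}$ means $\limsup \overline F(x-t)/\overline F(x)<\infty$ for all $t\ne 0$, and $F\in\mathcal{OS}$ means $\limsup\overline{F^{*2}}(x)/\overline F(x)<\infty$. **The classes $\mathcal F_3(0)$ and $\mathcal F_3(\gamma)$.** Let $\alpha\in\big(3/2,(\sqrt5+1)/2\big)$, $r=1+1/\alpha$, let $a>1$ satisfy $a^r>8a$, and let $a_n=a^{r^n}$, $n\ge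 0$. Let $\eta$ have law $P(\eta=a_n)=Ca_n^{-\alpha}$ with $C=\big(\sum_{n\ge 0}a_n^{-\alpha}\big)^{-1}$, and let $U$ be uniform on $(0,1)$ and independent of $\eta$. $\mathcal F_3(0)$ is the set of the laws $F_0$ of $\eta(1+U)$ for all such $\alpha,a$. For $\gamma>0$, $\mathcal F_3(\gamma)$ is the set of the distributions $F$ with $\overline F(x)=1$ for $x<0$ and $\overline F(x)=e^{-\gamma x}\overline{F_0}(x)$ for $x\ge 0$, for some $F_0\in\mathcal F_3(0)$. **Proposition 5.3.** Let $\gamma>0$ and let $F\in\mathcal F_3(\gamma)$ correspond to $F_0\in\mathcal F_3(0)$. Then: 1. $m(F)<\infty$; 2. $F^{*k}\in(\mathcal L(\gamma)\cap\mathcal{OS})\setminus\mathcal S(\gamma)$ for all $k\ge 2$; 3. $F\in\mathcal{OL}\setminus(\mathcal L(\gamma)\cup\mathcal{OS})$; 4. $F_0^{*k}\in\mathcal{OS}\setminus\mathcal L$ for all $k\ge 1$; 5. $\liminf\overline F(x-t)/\overline F(x)\ge e^{\gamma t}$ for all $t>0$, whereas $\overline F(x)=o\big(\overline{F^{*2}}(x)\big)$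 does not hold; 6. let $\tau$ be a random variable with values in $\{0,1,2,\dots\}$, $p_k=P(\tau=k)$, $P(\tau\ge 2)>0$, and $F^{*\tau}=\sum_{k\ge 0}p_kF^{*k}$. If for every $0<\varepsilon<1$ there is an integer $M\ge 0$ such that $$\sum_{k=M}^{\infty}p_{k+1}\overline{F^{*k}}(x)\le\varepsilon\,\overline{F^{*\tau}}(x)\quad\text{for all }x\ge 0,$$ then $F^{*\tau}\in(\mathcal L(\gamma)\cap\mathcal{OS})\setminus\mathcal S(\gamma)$. -/

import Mathlib

open MeasureTheory Set Filter Topology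
open scoped ENNReal

noncomputable section

/-- A distribution supported on the nonnegative half-line. -/
def IsDistribution (F : Measure ℝ) : Prop :=
  IsProbabilityMeasure F ∧ F (Iio 0) = 0

/-- The tail `x ↦ F((x, ∞))`. -/
def tail (F : Measure ℝ) (x : ℝ) : ℝ≥0∞ := F (Ioi x)

/-- The `k`-fold convolution power of `F`; the zeroth power is the point mass at `0`. -/
def convPow (F : Measure ℝ) : ℕ → Measure ℝ
  | 0 => Measure.dirac 0
  | k + 1 => (convPow F k).conv F

/-- The random convolution `∑ₖ P(τ = k) F^{*k}`; `τ` is given by its law on `ℕ`. -/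
def randomConv (F : Measure ℝ) (τ : PMF ℕ) : Measure ℝ :=
  Measure.sum fun k => τ k • convPow F k

/-- The exponential moment `m(F) = ∫_{[0, ∞)} e^{γ y} F(dy)`. -/
def expMoment (γ : ℝ) (F : Measure ℝ) : ℝ≥0∞ :=
  ∫⁻ y in Ici 0, ENNReal.ofReal (Real.exp (γ * y)) ∂F

/-- The distributions whose tail is everywhere positive, as is required for the ratios of tails
in the following classes to make sense. -/
def classPos : Set (Measure ℝ) :=
  {F | IsDistribution F ∧ ∀ x, 0 < tail F x}

/-- The class `L(γ)`: for every real `t`, `tail F (x - t) ∼ e^{γ t} tail F x` as `x → ∞`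
(along all real `x`, which is the definition for distributions that are not lattice). -/
def classL (γ : ℝ) : Set (Measure ℝ) :=
  {F | F ∈ classPos ∧ ∀ t : ℝ,
    Tendsto (fun x => tail F (x - t) / tail F x) atTop (𝓝 (ENNReal.ofReal (Real.exp (γ * t))))}

/-- The class `S(γ)`: members of `L(γ)` with `m(F) < ∞` and `tail F^{*2} ∼ 2 m(F) tail F`. -/
def classS (γ : ℝ) : Set (Measure ℝ) :=
  {F | F ∈ classL γ ∧ expMoment γ F < ⊤ ∧
    Tendsto (fun x => tail (convPow F 2) x / tail F x) atTop (𝓝 (2 * expMoment γ F))}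

/-- The generalized long-tailed class. -/
def classOL : Set (Measure ℝ) :=
  {F | F ∈ classPos ∧ ∀ t : ℝ, t ≠ 0 →
    limsup (fun x => tail F (x - t) / tail F x) atTop < ⊤}

/-- The generalized subexponential class. -/
def classOS : Set (Measure ℝ) :=
  {F | F ∈ classPos ∧ limsup (fun x => tail (convPow F 2) x / tail F x) atTop < ⊤}

/-- The points `aₙ = a^(rⁿ)` with `r = 1 + 1/α`. -/
def etaPoint (α a : ℝ) (n : ℕ) : ℝ := a ^ ((1 + 1 / α) ^ n)

/-- The law of `η`: `P(η = aₙ) = C aₙ^(-α)` with `C = (∑ₙ aₙ^(-α))⁻¹`. -/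
def etaLaw (α a : ℝ) : Measure ℝ :=
  Measure.sum fun n : ℕ =>
    ENNReal.ofReal ((∑' i : ℕ, etaPoint α a i ^ (-α))⁻¹ * etaPoint α a n ^ (-α)) •
      Measure.dirac (etaPoint α a n)

/-- The law of `ξ = η (1 + U)` with `U` uniform on `(0, 1)` and independent of `η`. -/
def xiLaw (α a : ℝ) : Measure ℝ :=
  ((etaLaw α a).prod (volume.restrict (Ioo (0 : ℝ) 1))).map fun p => p.1 * (1 + p.2)

/-- The two-parameter class `F₃(0)`. -/
def classF3Zero : Set (Measure ℝ) :=
  {F₀ | ∃ α a : ℝ, 3 / 2 < α ∧ α < (√5 + 1) / 2 ∧ 1 < a ∧ 8 * a < a ^ (1 + 1 / α) ∧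
    F₀ = xiLaw α a}

/-- `F` is the distribution `F_γ` with tail `1` on `(-∞, 0)` and `e^{-γ x} tail F₀ x`
on `[0, ∞)`. -/
def IsExpTransform (γ : ℝ) (F₀ F : Measure ℝ) : Prop :=
  IsProbabilityMeasure F ∧ ∀ x : ℝ,
    tail F x = if x < 0 then 1 else ENNReal.ofReal (Real.exp (-γ * x)) * tail F₀ x

end

/-! ### Tails and convolutions -/

/-! Write `κ n` for the density of `F₀` on its block `(a n, 2 a n)`; it is a constant times `a n ^
(-α - 1)`. The exponent `r = 1 + 1/α` is chosen so that block `n + 1` has total mass exactly `κ n`.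
Hence the tail of `F₀` at `2 a n` is of order `κ n`, the same order as its increment over a unit
step to the left. This prevents `F₀` and its convolution powers from being long-tailed, while the
tail remains Lipschitz at scale `x` with a constant at most its value at `x`
(`IsBlockLaw.tail_le_tail_add`). With a finite mean this gives `OS`.

After the transform, `tail F x = e^{-γ x} tail F₀ x`. Convolution then adds up splittings `x = y +
(x - y)` that all carry the same exponential factor. Near the end of block `n` they contribute
`e^{-γ x} κ n` times a quantity of order `κ n * a n ^ 3` (`le_transform_conv`). That quantity grows
like `a n ^ (2 - α)`, so it diverges because `α < 2`. Thus `F^{*2}` dominates the irregular part of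
`F`: the defect of `F` under shifts is negligible against `F^{*2}` (`transform_shiftNegl`), and `F`
itself is negligible along `2 a n` (`transform_sparse`). At the left end points `a n` the two tails
are still comparable.

On the other hand `F^{*3}` is of no larger order than `F^{*2}` (`transform_absorb`). The Lipschitz
bound produces an error `min(y, z)` times exponential weights; since `min(y, z) ≤ √y √z`, it is
integrable as soon as `F₀` has a moment of order `3/2`, and this is where `α > 3/2` enters.

These facts are collected in `AbsorbsConv`, and the rest is general. Negligibility of shift defects
survives convolution (`ShiftNegl.conv`), and a random convolution satisfying the Kesten condition
has a tail comparable to that of `F^{*2}`; this yields `L(γ)` and `OS`. Along the sparse sequence a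
fixed proportion of the tail comes from two large summands, which by Fatou is incompatible with
`S(γ)` (`notMem_classS_of_jointTail`). Convolution powers are the case of a degenerate `τ`. -/

lemma tail_antitone (A : Measure ℝ) : Antitone (tail A) := fun _ _ h =>
  measure_mono (Ioi_subset_Ioi h)

lemma measurable_tail (A : Measure ℝ) : Measurable (tail A) := (tail_antitone A).measurable

@[fun_prop]
lemma Measurable.tail_comp {X : Type*} [MeasurableSpace X] (A : Measure ℝ) {f : X → ℝ}
    (hf : Measurable f) : Measurable fun x => tail A (f x) := (measurable_tail A).comp hf

lemma tail_le_one (A : Measure ℝ) [IsProbabilityMeasure A] (x : ℝ) : tail A x ≤ 1 := prob_le_one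

lemma tail_ne_top (A : Measure ℝ) [IsProbabilityMeasure A] (x : ℝ) : tail A x ≠ ⊤ :=
  measure_ne_top _ _

lemma tail_of_neg {A : Measure ℝ} [IsProbabilityMeasure A] (hA : A (Iio 0) = 0) {x : ℝ}
    (hx : x < 0) : tail A x = 1 := by
  rw [tail, ← compl_Iic, prob_compl_eq_one_iff measurableSet_Iic]
  exact measure_mono_null (fun y hy => lt_of_le_of_lt hy hx) hA

lemma ae_nonneg_of_Iio {A : Measure ℝ} (hA : A (Iio 0) = 0) : ∀ᵐ y ∂A, 0 ≤ y := by
  rw [ae_iff]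
  convert hA using 2
  ext; simp

lemma tail_conv_eq_prod (A B : Measure ℝ) (x : ℝ) :
    tail (A.conv B) x = (A.prod B) {p | x < p.1 + p.2} := by
  rw [tail, Measure.conv, Measure.map_apply (by fun_prop) measurableSet_Ioi]
  rfl

lemma tail_conv (A B : Measure ℝ) [SFinite A] [SFinite B] (x : ℝ) :
    tail (A.conv B) x = ∫⁻ y, tail A (x - y) ∂B := by
  rw [tail_conv_eq_prod, Measure.prod_apply_symm (measurableSet_lt (by fun_prop) (by fun_prop))]
  refine lintegral_congr fun y => ?_
  rw [tail]
  congr 1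
  ext u
  simp [sub_lt_iff_lt_add]

lemma tail_conv_mono {A B : Measure ℝ} [SFinite A] [SFinite B] {K : ℝ≥0∞}
    (h : ∀ x, tail A x ≤ K * tail B x) (W : Measure ℝ) [SFinite W] (x : ℝ) :
    tail (A.conv W) x ≤ K * tail (B.conv W) x := by
  rw [tail_conv, tail_conv, ← lintegral_const_mul _ (by fun_prop)]
  exact lintegral_mono fun y => h _

lemma tail_le_tail_conv (A : Measure ℝ) [SFinite A] {W : Measure ℝ} [IsProbabilityMeasure W]
    (hW : W (Iio 0) = 0) (x : ℝ) : tail A x ≤ tail (A.conv W) x := by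
  rw [tail_conv]
  calc tail A x = ∫⁻ _, tail A x ∂W := by simp
    _ ≤ _ := by
      refine lintegral_mono_ae ?_
      filter_upwards [ae_nonneg_of_Iio hW] with y hy
      exact tail_antitone A (by linarith)

lemma conv_Iio_zero {A B : Measure ℝ} [SFinite A] [SFinite B] (hA : A (Iio 0) = 0)
    (hB : B (Iio 0) = 0) : (A.conv B) (Iio 0) = 0 := by
  rw [Measure.conv, Measure.map_apply (by fun_prop) measurableSet_Iio,
    Measure.prod_apply ((measurableSet_Iio).preimage (by fun_prop))]
  rw [lintegral_eq_zero_iff' (by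
    exact (measurable_measure_prodMk_left
      ((measurableSet_Iio).preimage (by fun_prop))).aemeasurable)]
  filter_upwards [ae_nonneg_of_Iio hA] with u hu
  refine measure_mono_null (fun y hy => ?_) hB
  simp only [mem_preimage, mem_Iio] at hy ⊢
  linarith

/-- The probability that `X > d`, `Y > c` and `X + Y > z`, for independent `X ∼ A` and `Y ∼ B`. -/
noncomputable def jointTail (A B : Measure ℝ) (d c z : ℝ) : ℝ≥0∞ :=
  (A.prod B) {p | d < p.1 ∧ c < p.2 ∧ z < p.1 + p.2}

lemma measurableSet_jointTail (d c z : ℝ) :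
    MeasurableSet {p : ℝ × ℝ | d < p.1 ∧ c < p.2 ∧ z < p.1 + p.2} := by
  simp only [ofPred_and]
  exact (measurableSet_lt (by fun_prop) (by fun_prop)).inter
    ((measurableSet_lt (by fun_prop) (by fun_prop)).inter
      (measurableSet_lt (by fun_prop) (by fun_prop)))

lemma jointTail_eq_left (A B : Measure ℝ) [SFinite A] [SFinite B] (d c z : ℝ) :
    jointTail A B d c z = ∫⁻ u in Ioi d, tail B (max c (z - u)) ∂A := by
  rw [jointTail, Measure.prod_apply (measurableSet_jointTail d c z),
    ← lintegral_indicator measurableSet_Ioi]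
  refine lintegral_congr fun u => ?_
  by_cases hu : d < u
  · rw [indicator_of_mem (by exact hu), tail]
    congr 1
    ext y
    simp [hu, sub_lt_iff_lt_add']
  · rw [indicator_of_notMem (by exact hu)]
    simp [hu]

lemma jointTail_comm (A B : Measure ℝ) [SFinite A] [SFinite B] (d c z : ℝ) :
    jointTail A B d c z = jointTail B A c d z := by
  rw [jointTail, jointTail, ← Measure.prod_swap,
    Measure.map_apply measurable_swap (measurableSet_jointTail d c z)]
  congr 1
  ext p
  simp only [mem_preimage, Prod.fst_swap, Prod.snd_swap, mem_ofPred_eq]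
  rw [add_comm]
  tauto

lemma jointTail_le (A B : Measure ℝ) [SFinite A] [SFinite B] (d c z : ℝ) :
    jointTail A B d c z ≤ tail A d * tail B c := by
  rw [tail, tail, ← Measure.prod_prod]
  exact measure_mono fun p hp => ⟨hp.1, hp.2.1⟩

lemma jointTail_mono_right (A : Measure ℝ) [SFinite A] {B B' : Measure ℝ} [SFinite B] [SFinite B']
    {K : ℝ≥0∞} (h : ∀ x, tail B x ≤ K * tail B' x) (d c z : ℝ) :
    jointTail A B d c z ≤ K * jointTail A B' d c z := by
  rw [jointTail_eq_left, jointTail_eq_left, ← lintegral_const_mul _ (by fun_prop)]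
  exact lintegral_mono fun u => h _

lemma jointTail_self_mono {A B : Measure ℝ} [SFinite A] [SFinite B]
    {K : ℝ≥0∞} (h : ∀ x, tail A x ≤ K * tail B x) (d c z : ℝ) :
    jointTail A A d c z ≤ K * (K * jointTail B B d c z) := by
  refine (jointTail_mono_right A h d c z).trans ?_
  rw [jointTail_comm]
  gcongr
  refine (jointTail_mono_right B h c d z).trans ?_
  rw [jointTail_comm]

/-- The condition `c + d ≤ z` makes the events `Y ≤ c` and `X ≤ d` incompatible once `X + Y > z`, so
the split is an exact equality. -/
lemma tail_conv_decomp (A B : Measure ℝ) [SFinite A] [SFinite B] {c d z : ℝ} (h : c + d ≤ z) :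
    tail (A.conv B) z = (∫⁻ y in Iic c, tail A (z - y) ∂B) + (∫⁻ u in Iic d, tail B (z - u) ∂A)
      + jointTail A B d c z := by
  have m1 : MeasurableSet {p : ℝ × ℝ | p.2 ≤ c ∧ z < p.1 + p.2} := by
    simp only [ofPred_and]
    exact (measurableSet_le (by fun_prop) (by fun_prop)).inter
      (measurableSet_lt (by fun_prop) (by fun_prop))
  have m2 : MeasurableSet {p : ℝ × ℝ | p.1 ≤ d ∧ z < p.1 + p.2} := by
    simp only [ofPred_and]
    exact (measurableSet_le (by fun_prop) (by fun_prop)).inter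
      (measurableSet_lt (by fun_prop) (by fun_prop))
  have e1 : (A.prod B) {p | p.2 ≤ c ∧ z < p.1 + p.2} = ∫⁻ y in Iic c, tail A (z - y) ∂B := by
    rw [Measure.prod_apply_symm m1, ← lintegral_indicator measurableSet_Iic]
    refine lintegral_congr fun y => ?_
    by_cases hy : y ≤ c
    · rw [indicator_of_mem (by exact hy), tail]
      congr 1
      ext u
      simp [hy, sub_lt_iff_lt_add]
    · rw [indicator_of_notMem (by exact hy)]
      simp [hy]
  have e2 : (A.prod B) {p | p.1 ≤ d ∧ z < p.1 + p.2} = ∫⁻ u in Iic d, tail B (z - u) ∂A := by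
    rw [Measure.prod_apply m2, ← lintegral_indicator measurableSet_Iic]
    refine lintegral_congr fun y => ?_
    by_cases hy : y ≤ d
    · rw [indicator_of_mem (by exact hy), tail]
      congr 1
      ext u
      simp [hy, sub_lt_iff_lt_add']
    · rw [indicator_of_notMem (by exact hy)]
      simp [hy]
  rw [tail_conv_eq_prod, ← e1, ← e2, jointTail, ← measure_union _ m2,
    ← measure_union _ (measurableSet_jointTail d c z)]
  · congr 1
    ext p
    simp only [mem_ofPred_eq, mem_union]
    constructor
    · intro hp
      by_cases h1 : p.2 ≤ c
      · exact .inl (.inl ⟨h1, hp⟩)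
      · by_cases h2 : p.1 ≤ d
        · exact .inl (.inr ⟨h2, hp⟩)
        · exact .inr ⟨not_le.1 h2, not_le.1 h1, hp⟩
    · rintro ((h | h) | h)
      exacts [h.2, h.2, h.2.2]
  · rw [Set.disjoint_left]
    rintro p (h1 | h1) ⟨h2, h3, -⟩
    · exact absurd h1.1 (not_le.2 h3)
    · exact absurd h1.1 (not_le.2 h2)
  · rw [Set.disjoint_left]
    rintro p ⟨h1, h2⟩ ⟨h3, -⟩
    linarith

/-! ### Convolution powers -/

instance isProbabilityMeasure_convPow (F : Measure ℝ) [IsProbabilityMeasure F] (k : ℕ) :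
    IsProbabilityMeasure (convPow F k) := by
  induction k with
  | zero => rw [convPow]; infer_instance
  | succ k ih => rw [convPow]; infer_instance

lemma convPow_one (F : Measure ℝ) [SFinite F] : convPow F 1 = F := by
  simp [convPow]

lemma convPow_two (F : Measure ℝ) [SFinite F] : convPow F 2 = F.conv F := by
  simp [convPow]

lemma convPow_Iio_zero {F : Measure ℝ} [IsProbabilityMeasure F] (hF : F (Iio 0) = 0) (k : ℕ) :
    (convPow F k) (Iio 0) = 0 := by
  induction k with
  | zero => simp [convPow]
  | succ k ih => rw [convPow]; exact conv_Iio_zero ih hF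

lemma convPow_add (F : Measure ℝ) [IsProbabilityMeasure F] (j k : ℕ) :
    convPow F (j + k) = (convPow F j).conv (convPow F k) := by
  induction k with
  | zero => simp [convPow]
  | succ k ih => rw [← add_assoc, convPow, convPow, ih, Measure.conv_assoc]

lemma tail_convPow_mono {F : Measure ℝ} [IsProbabilityMeasure F] (hF : F (Iio 0) = 0) {j k : ℕ}
    (h : j ≤ k) (x : ℝ) : tail (convPow F j) x ≤ tail (convPow F k) x := by
  obtain ⟨i, rfl⟩ := Nat.exists_eq_add_of_le h
  rw [convPow_add F j i]
  exact tail_le_tail_conv (convPow F j) (convPow_Iio_zero hF i) x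

lemma tail_le_tail_convPow {F : Measure ℝ} [IsProbabilityMeasure F] (hF : F (Iio 0) = 0) {k : ℕ}
    (h : 1 ≤ k) (x : ℝ) : tail F x ≤ tail (convPow F k) x := by
  simpa [convPow_one F] using tail_convPow_mono hF h x

/-- If `F^{*(i+1)}` has a tail dominated by that of `F^{*i}`, then so has `F^{*(i+j)}`. -/
lemma tail_convPow_add_le {F : Measure ℝ} [IsProbabilityMeasure F] {K : ℝ≥0∞} {i : ℕ}
    (h : ∀ x, tail (convPow F (i + 1)) x ≤ K * tail (convPow F i) x) (j : ℕ) (x : ℝ) :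
    tail (convPow F (i + j + 1)) x ≤ K * tail (convPow F (i + j)) x := by
  rw [show i + j + 1 = (i + 1) + j by ring, convPow_add F (i + 1) j, convPow_add F i j]
  exact tail_conv_mono h (convPow F j) x

lemma tail_convPow_add_le_pow {F : Measure ℝ} [IsProbabilityMeasure F] {K : ℝ≥0∞} {i : ℕ}
    (h : ∀ x, tail (convPow F (i + 1)) x ≤ K * tail (convPow F i) x) (j : ℕ) (x : ℝ) :
    tail (convPow F (i + j)) x ≤ K ^ j * tail (convPow F i) x := by
  induction j with
  | zero => simp
  | succ j ih =>
    rw [← add_assoc, pow_succ', mul_assoc]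
    exact (tail_convPow_add_le h j x).trans (by gcongr)

/-- Domination of the tail by its shift passes to convolution powers. -/
lemma tail_convPow_shift_le {F : Measure ℝ} [IsProbabilityMeasure F] {K : ℝ≥0∞} {t : ℝ}
    (h : ∀ x, tail F (x - t) ≤ K * tail F x) {k : ℕ} (hk : 1 ≤ k) (x : ℝ) :
    tail (convPow F k) (x - t) ≤ K * tail (convPow F k) x := by
  obtain ⟨i, rfl⟩ := Nat.exists_eq_add_of_le hk
  rw [convPow_add, convPow_one, tail_conv, tail_conv, ← lintegral_const_mul _ (by fun_prop)]
  refine lintegral_mono fun y => ?_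
  rw [sub_right_comm]
  exact h _

/-! ### Exponential moments -/

lemma expMoment_eq_lintegral {γ : ℝ} {A : Measure ℝ} (hA : A (Iio 0) = 0) :
    expMoment γ A = ∫⁻ y, ENNReal.ofReal (Real.exp (γ * y)) ∂A := by
  rw [expMoment, Measure.restrict_eq_self_of_ae_mem (s := Ici 0) (ae_nonneg_of_Iio hA)]

lemma expMoment_conv {γ : ℝ} {A B : Measure ℝ} [SFinite A] [SFinite B] (hA : A (Iio 0) = 0)
    (hB : B (Iio 0) = 0) : expMoment γ (A.conv B) = expMoment γ A * expMoment γ B := by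
  rw [expMoment_eq_lintegral hA, expMoment_eq_lintegral hB,
    expMoment_eq_lintegral (conv_Iio_zero hA hB), Measure.lintegral_conv (by fun_prop),
    ← lintegral_mul_const _ (by fun_prop)]
  refine lintegral_congr fun x => ?_
  rw [← lintegral_const_mul _ (by fun_prop)]
  refine lintegral_congr fun y => ?_
  rw [← ENNReal.ofReal_mul (by positivity), ← Real.exp_add, mul_add]

lemma expMoment_convPow {γ : ℝ} {F : Measure ℝ} [IsProbabilityMeasure F] (hF : F (Iio 0) = 0)
    (k : ℕ) : expMoment γ (convPow F k) = expMoment γ F ^ k := by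
  induction k with
  | zero =>
    rw [expMoment_eq_lintegral (convPow_Iio_zero hF 0)]
    simp [convPow]
  | succ k ih => rw [convPow, expMoment_conv (convPow_Iio_zero hF k) hF, ih, pow_succ]

/-- If the exponential moment is finite, the tail is `o(e^{-γ x})`. -/
lemma eventually_exp_mul_tail_le {γ : ℝ} (hγ : 0 ≤ γ) {A : Measure ℝ} [IsProbabilityMeasure A]
    (hA : A (Iio 0) = 0) (hm : expMoment γ A < ⊤) {ε : ℝ≥0∞} (hε : ε ≠ 0) :
    ∀ᶠ v in atTop, ENNReal.ofReal (Real.exp (γ * v)) * tail A v ≤ ε := by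
  rw [expMoment_eq_lintegral hA] at hm
  have h0 : Tendsto (fun v : ℝ => A (Ioi v)) atTop (𝓝 0) := by
    have h := tendsto_measure_iInter_atTop (μ := A) (s := fun v : ℝ => Ioi v)
      (fun v => measurableSet_Ioi.nullMeasurableSet) (fun _ _ h => Ioi_subset_Ioi h)
      ⟨0, measure_ne_top _ _⟩
    rwa [show ⋂ v : ℝ, Ioi v = ∅ by
      ext y; simp only [mem_iInter, mem_Ioi, mem_empty_iff_false, iff_false, not_forall]
      exact ⟨y, lt_irrefl y⟩, measure_empty] at h
  have h1 := tendsto_setLIntegral_zero hm.ne h0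
  filter_upwards [h1.eventually_le_const (pos_iff_ne_zero.2 hε)]
    with v hv
  refine le_trans ?_ hv
  rw [tail, ← setLIntegral_const]
  refine setLIntegral_mono (by fun_prop) fun y hy => ?_
  have := (mem_Ioi.1 hy).le
  gcongr

/-! ### Tails whose shifts are multiplicative up to a negligible error -/

/-- The tail of `A` satisfies `tail A (x - t) = e^{γ t} tail A x + o(W x)` for every `t > 0`. -/
def ShiftNegl (γ : ℝ) (W : ℝ → ℝ≥0∞) (A : Measure ℝ) : Prop :=
  ∀ t : ℝ, 0 < t → ∀ ε : ℝ≥0∞, ε ≠ 0 → ∀ᶠ x in atTop,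
    tail A (x - t) ≤ ENNReal.ofReal (Real.exp (γ * t)) * tail A x + ε * W x ∧
    ENNReal.ofReal (Real.exp (γ * t)) * tail A x ≤ tail A (x - t) + ε * W x

/-- Two factors are carried so that either inequality in `ShiftNegl` can be integrated: one of them
is `1` and the other is `e^{γ t}`. -/
lemma setLIntegral_le_mul_add {B : Measure ℝ} {f g w : ℝ → ℝ≥0∞} {c : ℝ} {E₁ E₂ ε K : ℝ≥0∞}
    (hf : Measurable f) (hg : Measurable g)
    (h : ∀ y ≤ c, E₁ * f y ≤ E₂ * g y + ε * w y) (hw : Measurable w) (hK : ∫⁻ y, w y ∂B ≤ K) :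
    E₁ * ∫⁻ y in Iic c, f y ∂B ≤ E₂ * (∫⁻ y in Iic c, g y ∂B) + ε * K := by
  rw [← lintegral_const_mul _ hf]
  calc ∫⁻ y in Iic c, E₁ * f y ∂B ≤ ∫⁻ y in Iic c, (E₂ * g y + ε * w y) ∂B :=
        setLIntegral_mono (by fun_prop) h
    _ = E₂ * (∫⁻ y in Iic c, g y ∂B) + ε * ∫⁻ y in Iic c, w y ∂B := by
        rw [lintegral_add_left (by fun_prop), lintegral_const_mul _ hg, lintegral_const_mul _ hw]
    _ ≤ _ := by
        gcongr
        exact (setLIntegral_le_lintegral _ _).trans hK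

/-- When one summand stays away from the level, the shift acts on the other summand and the defect
integrates to a multiple of `W`, because `W` is stable under convolution with `A` and with `B`. What
remains has both summands large, and the finite exponential moment of `A` makes it small. -/
theorem ShiftNegl.conv {γ : ℝ} (hγ : 0 ≤ γ) {W : ℝ → ℝ≥0∞} (hW : Measurable W) {A B : Measure ℝ}
    [IsProbabilityMeasure A] [IsProbabilityMeasure B] (hA : ShiftNegl γ W A)
    (hB : ShiftNegl γ W B) {K : ℝ≥0∞} (hK : K ≠ ⊤)
    (hWA : ∀ x, ∫⁻ y, W (x - y) ∂A ≤ K * W x) (hWB : ∀ x, ∫⁻ y, W (x - y) ∂B ≤ K * W x)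
    (hBW : ∀ x, tail B x ≤ W x) (hA0 : A (Iio 0) = 0) (hm : expMoment γ A < ⊤) :
    ShiftNegl γ W (A.conv B) := by
  intro t ht ε hε
  set E := ENNReal.ofReal (Real.exp (γ * t)) with hE
  have hE1 : 1 ≤ E := by
    rw [hE, ENNReal.one_le_ofReal, Real.one_le_exp_iff]; positivity
  have hEt : E ≠ ⊤ := ENNReal.ofReal_ne_top
  -- The error budget: one `K` for each of the two integrals, and the rest for the joint part
  -- multiplied by `E`.
  set Z := K + K + E * (E + 1) with hZ
  have hZt : Z ≠ ⊤ := by simp [hZ, ENNReal.mul_eq_top, hK, hEt]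
  obtain ⟨δ, hδ, hδε⟩ : ∃ δ : ℝ≥0∞, δ ≠ 0 ∧ δ * Z ≤ ε :=
    ⟨ε / Z, ENNReal.div_ne_zero.2 ⟨hε, hZt⟩, (mul_comm _ _).trans_le ENNReal.mul_div_le⟩
  obtain ⟨v₀, hv₀⟩ := eventually_atTop.1 ((hA t ht δ hδ).and (hB t ht δ hδ))
  -- The threshold `v` is fixed before `x`. The weight `e^{γ (v - t)}` is the one that appears when
  -- `tail B (x - v)` is traded for `tail B x`.
  obtain ⟨v, hv1, hv2, hv3⟩ : ∃ v, v₀ ≤ v ∧ 0 < v ∧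
      ENNReal.ofReal (Real.exp (γ * (v - t))) * tail A (v - t) ≤ δ :=
    ((eventually_ge_atTop v₀).and ((eventually_gt_atTop 0).and
      ((tendsto_atTop_add_const_right _ (-t) tendsto_id).eventually
        (eventually_exp_mul_tail_le hγ hA0 hm hδ)))).exists
  filter_upwards [eventually_ge_atTop (2 * v), hB v hv2 δ hδ] with x hx hBx
  have hR : tail A (v - t) * tail B (x - v) ≤ δ * (E + 1) * W x := by
    calc tail A (v - t) * tail B (x - v)
        ≤ tail A (v - t) * (ENNReal.ofReal (Real.exp (γ * v)) * tail B x + δ * W x) := by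
          gcongr; exact hBx.1
      _ = (ENNReal.ofReal (Real.exp (γ * (v - t))) * tail A (v - t)) * E * tail B x
            + tail A (v - t) * (δ * W x) := by
          rw [show γ * v = γ * (v - t) + γ * t by ring, Real.exp_add,
            ENNReal.ofReal_mul (by positivity)]
          ring
      _ ≤ δ * E * W x + 1 * (δ * W x) := by
          gcongr
          · exact hBW x
          · exact tail_le_one A _
      _ = _ := by ring
  -- The same thresholds, with sum `x - t`, serve both levels `x - t` and `x`, so the integrals can
  -- be compared term by term.
  have d1 := tail_conv_decomp A B (c := x - v) (d := v - t) (z := x - t) (by linarith)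
  have d2 := tail_conv_decomp A B (c := x - v) (d := v - t) (z := x) (by linarith)
  have j1 := (jointTail_le A B (v - t) (x - v) (x - t)).trans hR
  have j2 := (jointTail_le A B (v - t) (x - v) x).trans hR
  have a1 : 1 * ∫⁻ y in Iic (x - v), tail A (x - t - y) ∂B ≤
      E * (∫⁻ y in Iic (x - v), tail A (x - y) ∂B) + δ * (K * W x) :=
    setLIntegral_le_mul_add (w := fun y => W (x - y)) (by fun_prop) (by fun_prop)
      (fun y hy => by
        rw [one_mul, sub_right_comm]
        exact (hv₀ (x - y) (by linarith)).1.1) (by fun_prop) (hWB x)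
  have a2 : E * ∫⁻ y in Iic (x - v), tail A (x - y) ∂B ≤
      1 * (∫⁻ y in Iic (x - v), tail A (x - t - y) ∂B) + δ * (K * W x) :=
    setLIntegral_le_mul_add (w := fun y => W (x - y)) (by fun_prop) (by fun_prop)
      (fun y hy => by
        rw [one_mul, sub_right_comm]
        exact (hv₀ (x - y) (by linarith)).1.2) (by fun_prop) (hWB x)
  have b1 : 1 * ∫⁻ y in Iic (v - t), tail B (x - t - y) ∂A ≤
      E * (∫⁻ y in Iic (v - t), tail B (x - y) ∂A) + δ * (K * W x) :=
    setLIntegral_le_mul_add (w := fun y => W (x - y)) (by fun_prop) (by fun_prop)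
      (fun y hy => by
        rw [one_mul, sub_right_comm]
        exact (hv₀ (x - y) (by linarith)).2.1) (by fun_prop) (hWA x)
  have b2 : E * ∫⁻ y in Iic (v - t), tail B (x - y) ∂A ≤
      1 * (∫⁻ y in Iic (v - t), tail B (x - t - y) ∂A) + δ * (K * W x) :=
    setLIntegral_le_mul_add (w := fun y => W (x - y)) (by fun_prop) (by fun_prop)
      (fun y hy => by
        rw [one_mul, sub_right_comm]
        exact (hv₀ (x - y) (by linarith)).2.2) (by fun_prop) (hWA x)
  rw [one_mul] at a1 a2 b1 b2
  rw [d1, d2]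
  constructor
  · calc _ ≤ (E * (∫⁻ y in Iic (x - v), tail A (x - y) ∂B) + δ * (K * W x))
          + (E * (∫⁻ y in Iic (v - t), tail B (x - y) ∂A) + δ * (K * W x))
          + 1 * (δ * (E + 1) * W x) := by rw [one_mul]; gcongr
      _ ≤ (E * (∫⁻ y in Iic (x - v), tail A (x - y) ∂B) + δ * (K * W x))
          + (E * (∫⁻ y in Iic (v - t), tail B (x - y) ∂A) + δ * (K * W x))
          + E * (δ * (E + 1) * W x) := by gcongr
      _ = E * ((∫⁻ y in Iic (x - v), tail A (x - y) ∂B)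
          + (∫⁻ y in Iic (v - t), tail B (x - y) ∂A)) + δ * Z * W x := by rw [hZ]; ring
      _ ≤ _ := add_le_add (mul_le_mul' le_rfl le_self_add) (mul_le_mul' hδε le_rfl)
  · calc _ = E * (∫⁻ y in Iic (x - v), tail A (x - y) ∂B)
          + E * (∫⁻ y in Iic (v - t), tail B (x - y) ∂A) + E * jointTail A B (v - t) (x - v) x := by
          ring
      _ ≤ ((∫⁻ y in Iic (x - v), tail A (x - t - y) ∂B) + δ * (K * W x))
          + ((∫⁻ y in Iic (v - t), tail B (x - t - y) ∂A) + δ * (K * W x))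
          + E * (δ * (E + 1) * W x) := by gcongr
      _ = ((∫⁻ y in Iic (x - v), tail A (x - t - y) ∂B)
          + (∫⁻ y in Iic (v - t), tail B (x - t - y) ∂A)) + δ * Z * W x := by rw [hZ]; ring
      _ ≤ _ := add_le_add le_self_add (mul_le_mul' hδε le_rfl)

/-! ### Absorbing small errors in `ℝ≥0∞` -/

/-- The cap `2⁻¹` keeps `δ` finite and below `1`, which `ε / C` alone would not ensure. -/
lemma exists_ne_zero_mul_le {C ε : ℝ≥0∞} (hC : C ≠ ⊤) (hε : ε ≠ 0) :
    ∃ δ : ℝ≥0∞, δ ≠ 0 ∧ δ ≤ 2⁻¹ ∧ δ * C ≤ ε := by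
  refine ⟨min (ε / C) 2⁻¹, ?_, min_le_right _ _, ?_⟩
  · have h1 : ε / C ≠ 0 := ENNReal.div_ne_zero.2 ⟨hε, hC⟩
    rcases min_choice (ε / C) 2⁻¹ with h | h <;> rw [h]
    · exact h1
    · simp
  · calc min (ε / C) 2⁻¹ * C ≤ ε / C * C := by gcongr; exact min_le_left _ _
      _ ≤ ε := (mul_comm _ _).trans_le ENNReal.mul_div_le

lemma le_two_mul_of_le_add_half {a b : ℝ≥0∞} (ha : a ≠ ⊤) (h : a ≤ b + 2⁻¹ * a) : a ≤ 2 * b := by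
  have h1 : 2⁻¹ * a ≠ ⊤ := ENNReal.mul_ne_top (by simp) ha
  have h2 : 2⁻¹ * a + 2⁻¹ * a ≤ b + 2⁻¹ * a := by
    rwa [← add_mul, ENNReal.inv_two_add_inv_two, one_mul]
  have h3 : 2⁻¹ * a ≤ b := (ENNReal.add_le_add_iff_right h1).1 h2
  calc a = 2 * (2⁻¹ * a) := by
        rw [← mul_assoc, ENNReal.mul_inv_cancel (by simp) (by simp), one_mul]
    _ ≤ 2 * b := by gcongr

/-! ### Membership criteria for the classes -/

lemma tendsto_ratio_of_shiftNegl {γ : ℝ} {A : Measure ℝ} [IsProbabilityMeasure A]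
    (hpos : ∀ x, 0 < tail A x) (h : ShiftNegl γ (tail A) A) {t : ℝ} (ht : 0 < t) :
    Tendsto (fun x => tail A (x - t) / tail A x) atTop
      (𝓝 (ENNReal.ofReal (Real.exp (γ * t)))) := by
  rw [ENNReal.tendsto_nhds ENNReal.ofReal_ne_top]
  intro ε hε
  filter_upwards [h t ht ε hε.ne'] with x hx
  have h0 := (hpos x).ne'
  have h1 := tail_ne_top A x
  constructor
  · rw [tsub_le_iff_right]
    have : tail A (x - t) / tail A x + ε = (tail A (x - t) + ε * tail A x) / tail A x := by
      rw [ENNReal.add_div, ENNReal.mul_div_cancel_right h0 h1]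
    rw [this, ENNReal.le_div_iff_mul_le (.inl h0) (.inl h1)]
    exact hx.2
  · refine ENNReal.div_le_of_le_mul ?_
    rw [add_mul]
    exact hx.1

lemma mem_classL_of_shiftNegl {γ : ℝ} {A : Measure ℝ} [IsProbabilityMeasure A]
    (hA : A (Iio 0) = 0) (hpos : ∀ x, 0 < tail A x) (h : ShiftNegl γ (tail A) A) :
    A ∈ classL γ := by
  refine ⟨⟨⟨inferInstance, hA⟩, hpos⟩, fun t => ?_⟩
  rcases lt_trichotomy t 0 with ht | rfl | ht
  -- A negative shift is the reciprocal of a positive one, evaluated at the translated point `x -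
  -- t`.
  · have h1 := ((tendsto_ratio_of_shiftNegl hpos h (neg_pos.2 ht)).comp
      (tendsto_atTop_add_const_right atTop (-t) tendsto_id)).inv
    rw [← ENNReal.ofReal_inv_of_pos (Real.exp_pos _), ← Real.exp_neg] at h1
    refine (h1.congr fun x => ?_).trans (by simp)
    simp only [Function.comp_apply, id]
    rw [ENNReal.inv_div (.inl (tail_ne_top A _)) (.inl (hpos _).ne')]
    simp [sub_eq_add_neg]
  · simp only [sub_zero, mul_zero, Real.exp_zero, ENNReal.ofReal_one]
    refine tendsto_const_nhds.congr fun x => ?_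
    rw [ENNReal.div_self (hpos x).ne' (tail_ne_top A x)]
  · exact tendsto_ratio_of_shiftNegl hpos h ht

lemma mem_classOS_of_le {A : Measure ℝ} [IsProbabilityMeasure A] (hA : A (Iio 0) = 0)
    (hpos : ∀ x, 0 < tail A x) {K : ℝ≥0∞} (hK : K ≠ ⊤)
    (h : ∀ x, tail (A.conv A) x ≤ K * tail A x) : A ∈ classOS := by
  refine ⟨⟨⟨inferInstance, hA⟩, hpos⟩, lt_of_le_of_lt ?_ hK.lt_top⟩
  refine limsup_le_of_le (by isBoundedDefault) (Eventually.of_forall fun x => ?_)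
  rw [convPow_two]
  exact ENNReal.div_le_of_le_mul (h x)

/-! ### Random convolutions -/

lemma tail_randomConv (F : Measure ℝ) (τ : PMF ℕ) (x : ℝ) :
    tail (randomConv F τ) x = ∑' k, τ k * tail (convPow F k) x := by
  simp [tail, randomConv, Measure.sum_apply _ measurableSet_Ioi]

instance isProbabilityMeasure_randomConv (F : Measure ℝ) [IsProbabilityMeasure F] (τ : PMF ℕ) :
    IsProbabilityMeasure (randomConv F τ) :=
  ⟨by simp [randomConv, Measure.sum_apply _ MeasurableSet.univ]⟩

lemma randomConv_Iio_zero {F : Measure ℝ} [IsProbabilityMeasure F] (hF : F (Iio 0) = 0)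
    (τ : PMF ℕ) : randomConv F τ (Iio 0) = 0 := by
  simp [randomConv, Measure.sum_apply _ measurableSet_Iio, convPow_Iio_zero hF]

/-- This makes the statement on convolution powers a special case of the one on random convolutions.
-/
lemma randomConv_pure (F : Measure ℝ) (k : ℕ) : randomConv F (PMF.pure k) = convPow F k := by
  refine Measure.ext fun s hs => ?_
  rw [randomConv, Measure.sum_apply _ hs, tsum_eq_single k]
  · simp
  · intro j hj
    simp [hj]

lemma tail_convPow_le_randomConv (F : Measure ℝ) {τ : PMF ℕ} {k : ℕ} (hk : τ k ≠ 0) (x : ℝ) :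
    tail (convPow F k) x ≤ (τ k)⁻¹ * tail (randomConv F τ) x := by
  calc tail (convPow F k) x = (τ k)⁻¹ * (τ k * tail (convPow F k) x) := by
        rw [← mul_assoc, ENNReal.inv_mul_cancel hk (τ.apply_ne_top k), one_mul]
    _ ≤ _ := by
        rw [tail_randomConv]
        gcongr
        exact ENNReal.le_tsum (f := fun k => τ k * tail (convPow F k) x) k

lemma tail_randomConv_split (F : Measure ℝ) (τ : PMF ℕ) (N : ℕ) (x : ℝ) :
    tail (randomConv F τ) x = ∑ k ∈ Finset.range N, τ k * tail (convPow F k) x +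
      ∑' j, τ (N + j) * tail (convPow F (N + j)) x := by
  rw [tail_randomConv, ← Summable.sum_add_tsum_nat_add'
    (f := fun k => τ k * tail (convPow F k) x) (k := N) ENNReal.summable]
  simp only [add_comm N]

/-! ### Distributions whose convolution square absorbs further convolution -/

/-- The properties of `F` on which the closure results below rest: convolving `F^{*2}` with `F` does
not change the order of its tail, and shifting the tail of `F` is multiplicative up to an error
that `F^{*2}` dominates, although `tail F` is negligible against `tail F^{*2}` along a sequence. -/
structure AbsorbsConv (γ : ℝ) (F : Measure ℝ) : Prop where
  prob : IsProbabilityMeasure F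
  nonneg : F (Iio 0) = 0
  tail_pos : ∀ x, 0 < tail F x
  moment : expMoment γ F < ⊤
  absorb : ∃ K : ℝ≥0∞, K ≠ ⊤ ∧ ∀ x, tail (convPow F 3) x ≤ K * tail (convPow F 2) x
  shift : ∀ t : ℝ, 0 < t → ∃ K : ℝ≥0∞, K ≠ ⊤ ∧ ∀ x, tail F (x - t) ≤ K * tail F x
  negl : ShiftNegl γ (tail (convPow F 2)) F
  sparse : ∃ u : ℕ → ℝ, Tendsto u atTop atTop ∧ ∀ ε : ℝ≥0∞, ε ≠ 0 →
    ∀ᶠ n in atTop, tail F (u n) ≤ ε * tail (convPow F 2) (u n)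

/-- Induction with `ShiftNegl.conv`, keeping the reference tail `F^{*2}` fixed: absorption bounds
its convolution with `F^{*j}` by `K ^ j` times itself. -/
lemma AbsorbsConv.shiftNegl_convPow {γ : ℝ} (hγ : 0 ≤ γ) {F : Measure ℝ} (h : AbsorbsConv γ F)
    (k : ℕ) : ShiftNegl γ (tail (convPow F 2)) (convPow F k) := by
  have := h.prob
  obtain ⟨K, hK, hK3⟩ := h.absorb
  rcases Nat.eq_zero_or_pos k with rfl | hk
  · intro t ht ε hε
    filter_upwards [eventually_ge_atTop t] with x hx
    have h1 : ∀ y : ℝ, 0 ≤ y → tail (convPow F 0) y = 0 := fun y hy => by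
      simp [tail, convPow, hy]
    rw [h1 x (by linarith), h1 (x - t) (by linarith)]
    simp
  induction k, hk using Nat.le_induction with
  | base => rw [convPow_one]; exact h.negl
  | succ k hk ih =>
    have hbound : ∀ j x, ∫⁻ y, tail (convPow F 2) (x - y) ∂(convPow F j) ≤
        K ^ j * tail (convPow F 2) x := fun j x => by
      rw [← tail_conv, ← convPow_add]
      exact tail_convPow_add_le_pow hK3 j x
    rw [convPow_add F k 1, convPow_one]
    refine ShiftNegl.conv hγ (measurable_tail _) ih h.negl (K := K ^ k + K) (by simp [hK])
      (fun x => (hbound k x).trans ?_) (fun x => ?_) (tail_le_tail_convPow h.nonneg (by norm_num))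
      (convPow_Iio_zero h.nonneg k) ?_
    · gcongr; exact le_self_add
    · have h1 := hbound 1 x
      rw [convPow_one, pow_one] at h1
      refine h1.trans ?_
      gcongr; exact le_add_self
    · rw [expMoment_convPow h.nonneg]
      exact ENNReal.pow_lt_top h.moment

/-- The condition of Kesten type on the law of `τ`. -/
def KestenCondition (F : Measure ℝ) (τ : PMF ℕ) : Prop :=
  ∀ ε : ℝ, 0 < ε → ε < 1 → ∃ M : ℕ, ∀ x : ℝ, 0 ≤ x →
    ∑' j : ℕ, τ (M + j + 1) * tail (convPow F (M + j)) x ≤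
      ENNReal.ofReal ε * tail (randomConv F τ) x

/-- The Kesten condition pairs `p_{k+1}` with `F^{*k}`. Absorption replaces `F^{*k}` by `F^{*(k+1)}`
at the cost of `K`, and the weights then match the remainder of the series. -/
lemma KestenCondition.remainder_le {γ : ℝ} {F : Measure ℝ} (h : AbsorbsConv γ F) {τ : PMF ℕ}
    (hτ : KestenCondition F τ) {δ : ℝ≥0∞} (hδ : δ ≠ 0) :
    ∃ N : ℕ, 1 ≤ N ∧ ∀ x : ℝ, 0 ≤ x →
      ∑' j, τ (N + j) * tail (convPow F (N + j)) x ≤ δ * tail (randomConv F τ) x := by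
  have := h.prob
  obtain ⟨K, hK, hK3⟩ := h.absorb
  obtain ⟨ε, hε0, hε2, hεK⟩ := exists_ne_zero_mul_le hK hδ
  have hεt : ε ≠ ⊤ := ne_top_of_le_ne_top (by simp) hε2
  obtain ⟨M, hM⟩ := hτ ε.toReal (ENNReal.toReal_pos hε0 hεt) (by
    have h1 := ENNReal.toReal_mono (by simp) hε2
    rw [ENNReal.toReal_inv] at h1
    norm_num at h1
    linarith)
  rw [ENNReal.ofReal_toReal hεt] at hM
  -- Absorption is available only from the second power on, so the series starts at `p_{M+3}`,
  -- paired with `F^{*(M+2)}`.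
  refine ⟨M + 3, by omega, fun x hx => ?_⟩
  calc ∑' j, τ (M + 3 + j) * tail (convPow F (M + 3 + j)) x
      ≤ ∑' j, K * (τ (M + (j + 2) + 1) * tail (convPow F (M + (j + 2))) x) := by
        refine ENNReal.tsum_le_tsum fun j => ?_
        have h1 := tail_convPow_add_le hK3 (M + j) x
        rw [show M + 3 + j = 2 + (M + j) + 1 by ring, show M + (j + 2) = 2 + (M + j) by ring,
          mul_left_comm]
        gcongr
    _ = K * ∑' j, τ (M + (j + 2) + 1) * tail (convPow F (M + (j + 2))) x := ENNReal.tsum_mul_left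
    _ ≤ K * ∑' j, τ (M + j + 1) * tail (convPow F (M + j)) x := by
        refine mul_le_mul' le_rfl ?_
        exact ENNReal.tsum_comp_le_tsum_of_injective (f := fun j : ℕ => j + 2)
          (fun a b hab => by simpa using hab)
          (fun j => τ (M + j + 1) * tail (convPow F (M + j)) x)
    _ ≤ K * (ε * tail (randomConv F τ) x) := by gcongr; exact hM x hx
    _ = ε * K * tail (randomConv F τ) x := by ring
    _ ≤ _ := by gcongr

/-- The remainder is at most half of the whole tail, so the finite part carries at least the other
half. -/
lemma AbsorbsConv.tail_randomConv_le {γ : ℝ} {F : Measure ℝ} (h : AbsorbsConv γ F) {τ : PMF ℕ}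
    (hτ : KestenCondition F τ) :
    ∃ C : ℝ≥0∞, C ≠ ⊤ ∧ ∀ x, tail (randomConv F τ) x ≤ C * tail (convPow F 2) x := by
  have := h.prob
  obtain ⟨K, hK, hK3⟩ := h.absorb
  obtain ⟨N, hN, hrem⟩ := hτ.remainder_le h (δ := 2⁻¹) (by simp)
  -- The final `+ 1` covers `x < 0`, where the Kesten condition says nothing but both tails are at
  -- most `1 = tail (convPow F 2) x`.
  refine ⟨2 * (∑ k ∈ Finset.range N, K ^ k) + 1, ?_, fun x => ?_⟩
  · refine ENNReal.add_ne_top.2 ⟨ENNReal.mul_ne_top (by simp) ?_, by simp⟩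
    exact (ENNReal.sum_lt_top.2 fun k _ => ENNReal.pow_lt_top hK.lt_top).ne
  rcases lt_or_ge x 0 with hx | hx
  · rw [tail_of_neg (convPow_Iio_zero h.nonneg 2) hx, mul_one]
    exact (tail_le_one _ _).trans le_add_self
  · rw [add_mul, mul_assoc]
    refine le_add_right (le_two_mul_of_le_add_half (tail_ne_top _ _) ?_)
    calc tail (randomConv F τ) x = _ := tail_randomConv_split F τ N x
      _ ≤ (∑ k ∈ Finset.range N, K ^ k) * tail (convPow F 2) x
          + 2⁻¹ * tail (randomConv F τ) x := by
        refine add_le_add ?_ (hrem x hx)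
        rw [Finset.sum_mul]
        refine Finset.sum_le_sum fun k _ => ?_
        calc τ k * tail (convPow F k) x ≤ 1 * tail (convPow F (2 + k)) x := by
              gcongr
              · exact τ.coe_le_one k
              · exact tail_convPow_mono h.nonneg (by omega) x
          _ ≤ _ := by
              rw [one_mul]
              exact tail_convPow_add_le_pow hK3 k x

/-- Finitely many powers are treated by `shiftNegl_convPow`. The remainder is small at `x`, and also
at `x - t` because a shift costs every positive power the same constant `L`. -/
lemma AbsorbsConv.shiftNegl_randomConv {γ : ℝ} (hγ : 0 ≤ γ) {F : Measure ℝ} (h : AbsorbsConv γ F)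
    {τ : PMF ℕ} (hτ : KestenCondition F τ) {C : ℝ≥0∞} (hC : C ≠ ⊤)
    (hWH : ∀ x, tail (convPow F 2) x ≤ C * tail (randomConv F τ) x) :
    ShiftNegl γ (tail (randomConv F τ)) (randomConv F τ) := by
  have := h.prob
  intro t ht ε hε
  obtain ⟨L, hL, hLt⟩ := h.shift t ht
  set E := ENNReal.ofReal (Real.exp (γ * t)) with hE
  have hEt : E ≠ ⊤ := ENNReal.ofReal_ne_top
  obtain ⟨δ, hδ0, -, hδ⟩ := exists_ne_zero_mul_le (C := C + (L + E)) (by simp [hC, hL, hEt]) hε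
  obtain ⟨N, hN, hrem⟩ := hτ.remainder_le h hδ0
  have hfin : ∀ᶠ x in atTop, ∀ k ∈ Finset.range N,
      tail (convPow F k) (x - t) ≤ E * tail (convPow F k) x + δ * tail (convPow F 2) x ∧
      E * tail (convPow F k) x ≤ tail (convPow F k) (x - t) + δ * tail (convPow F 2) x :=
    (Finset.range N).eventually_all.2 fun k _ => h.shiftNegl_convPow hγ k t ht δ hδ0
  have hsum : ∑ k ∈ Finset.range N, τ k ≤ 1 := by
    rw [← τ.tsum_coe]; exact ENNReal.sum_le_tsum _
  filter_upwards [hfin, eventually_ge_atTop 0] with x hx hx0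
  have hfold : ∀ f g : ℕ → ℝ≥0∞, (∀ k ∈ Finset.range N, f k ≤ g k + δ * tail (convPow F 2) x) →
      ∑ k ∈ Finset.range N, τ k * f k ≤ ∑ k ∈ Finset.range N, τ k * g k
        + δ * tail (convPow F 2) x := fun f g hfg => by
    calc ∑ k ∈ Finset.range N, τ k * f k
        ≤ ∑ k ∈ Finset.range N, (τ k * g k + τ k * (δ * tail (convPow F 2) x)) :=
          Finset.sum_le_sum fun k hk => by rw [← mul_add]; gcongr; exact hfg k hk
      _ = ∑ k ∈ Finset.range N, τ k * g k
          + (∑ k ∈ Finset.range N, τ k) * (δ * tail (convPow F 2) x) := by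
          rw [Finset.sum_add_distrib, Finset.sum_mul]
      _ ≤ ∑ k ∈ Finset.range N, τ k * g k + 1 * (δ * tail (convPow F 2) x) := by gcongr
      _ = _ := by rw [one_mul]
  have e1 := hfold _ _ fun k hk => (hx k hk).1
  have e2 := hfold _ _ fun k hk => (hx k hk).2
  have hmul : ∑ k ∈ Finset.range N, τ k * (E * tail (convPow F k) x) =
      E * ∑ k ∈ Finset.range N, τ k * tail (convPow F k) x := by
    rw [Finset.mul_sum]
    exact Finset.sum_congr rfl fun k _ => by ring
  rw [hmul] at e1 e2
  have hW : δ * tail (convPow F 2) x ≤ δ * C * tail (randomConv F τ) x := by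
    rw [mul_assoc]; gcongr; exact hWH x
  have hV : ∑' j, τ (N + j) * tail (convPow F (N + j)) (x - t) ≤
      δ * L * tail (randomConv F τ) x := by
    calc ∑' j, τ (N + j) * tail (convPow F (N + j)) (x - t)
        ≤ ∑' j, L * (τ (N + j) * tail (convPow F (N + j)) x) := by
          refine ENNReal.tsum_le_tsum fun j => ?_
          rw [mul_left_comm]
          gcongr
          exact tail_convPow_shift_le hLt (by omega) x
      _ = L * ∑' j, τ (N + j) * tail (convPow F (N + j)) x := ENNReal.tsum_mul_left
      _ ≤ L * (δ * tail (randomConv F τ) x) := by gcongr; exact hrem x hx0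
      _ = _ := by ring
  have hE2 : E * ∑' j, τ (N + j) * tail (convPow F (N + j)) x ≤
      δ * E * tail (randomConv F τ) x := by
    calc _ ≤ E * (δ * tail (randomConv F τ) x) := by gcongr; exact hrem x hx0
      _ = _ := by ring
  have hs1 := tail_randomConv_split F τ N (x - t)
  have hs2 := tail_randomConv_split F τ N x
  set R := tail (randomConv F τ) x with hR
  set S := ∑ k ∈ Finset.range N, τ k * tail (convPow F k) x
  set S' := ∑ k ∈ Finset.range N, τ k * tail (convPow F k) (x - t)
  constructor
  · calc tail (randomConv F τ) (x - t) ≤ (E * S + δ * C * R) + δ * L * R := by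
          rw [hs1]
          exact add_le_add (e1.trans (by gcongr)) hV
      _ = E * S + δ * (C + L) * R := by ring
      _ ≤ E * R + ε * R := by
          refine add_le_add (mul_le_mul' le_rfl ?_) (mul_le_mul' (le_trans ?_ hδ) le_rfl)
          · rw [hs2]; exact le_self_add
          · gcongr; exact le_self_add
  · calc E * R ≤ (S' + δ * C * R) + δ * E * R := by
          rw [hs2, mul_add, ← hs2]
          exact add_le_add (e2.trans (by gcongr)) hE2
      _ = S' + δ * (C + E) * R := by ring
      _ ≤ tail (randomConv F τ) (x - t) + ε * R := by
          refine add_le_add ?_ (mul_le_mul' (le_trans ?_ hδ) le_rfl)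
          · rw [hs1]; exact le_self_add
          · gcongr; exact le_add_self

/-! ### A criterion for not being convolution equivalent -/

lemma setLIntegral_tail_sub_le (A : Measure ℝ) {B : Measure ℝ} [IsProbabilityMeasure B]
    (c x : ℝ) : ∫⁻ y in Iic c, tail A (x - y) ∂B ≤ tail A (x - c) := by
  calc ∫⁻ y in Iic c, tail A (x - y) ∂B ≤ ∫⁻ _ in Iic c, tail A (x - c) ∂B :=
        setLIntegral_mono (by fun_prop) fun y hy => tail_antitone A (by
          have := mem_Iic.1 hy; linarith)
    _ = tail A (x - c) * B (Iic c) := setLIntegral_const _ _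
    _ ≤ tail A (x - c) * 1 := by gcongr; exact prob_le_one
    _ = _ := mul_one _

/-- If along some sequence the sums of two large terms keep a fixed proportion of the tail, the
distribution is not in `S(γ)`. -/
lemma notMem_classS_of_jointTail {γ : ℝ} {H : Measure ℝ} [IsProbabilityMeasure H] {u : ℕ → ℝ}
    (hu : Tendsto u atTop atTop) {B : ℝ≥0∞} (hB : B ≠ ⊤)
    (h : ∀ A : ℝ, 0 < A → ∀ᶠ n in atTop, tail H (u n) ≤ B * jointTail H H A A (u n)) :
    H ∉ classS γ := by
  rintro ⟨⟨⟨⟨-, hH0⟩, hpos⟩, hL⟩, hm, hS⟩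
  set m := expMoment γ H with hm_def
  have key : ∀ A : ℝ, 0 < A →
      2 * (∫⁻ y in Iic A, ENNReal.ofReal (Real.exp (γ * y)) ∂H) + B⁻¹ ≤ 2 * m := by
    intro A hA
    -- Fatou is applied to the two integrals over `Iic A` together with the joint part. The latter
    -- enters as the constant `B⁻¹`, whose integral is itself since `H` has mass one.
    set f : ℕ → ℝ → ℝ≥0∞ := fun n y =>
      (Iic A).indicator (fun y => 2 * (tail H (u n - y) / tail H (u n))) y + B⁻¹ with hf
    have hfm : ∀ n, Measurable (f n) := fun n =>
      (Measurable.indicator (by fun_prop) measurableSet_Iic).add_const _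
    have hlim : ∀ y, liminf (fun n => f n y) atTop =
        (Iic A).indicator (fun y => 2 * ENNReal.ofReal (Real.exp (γ * y))) y + B⁻¹ := by
      intro y
      refine Tendsto.liminf_eq ?_
      refine Tendsto.add ?_ tendsto_const_nhds
      by_cases hy : y ∈ Iic A
      · simp only [indicator_of_mem hy]
        exact ENNReal.Tendsto.const_mul ((hL y).comp hu) (.inr (by simp))
      · simp only [indicator_of_notMem hy]
        exact tendsto_const_nhds
    have hint : ∀ᶠ n in atTop, ∫⁻ y, f n y ∂H ≤ tail (convPow H 2) (u n) / tail H (u n) := by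
      filter_upwards [h A hA, hu.eventually_ge_atTop (A + A)] with n hn hn2
      have h0 := (hpos (u n)).ne'
      have h1 := tail_ne_top H (u n)
      rw [hf, lintegral_add_right _ measurable_const, lintegral_indicator measurableSet_Iic,
        lintegral_const, measure_univ, mul_one, convPow_two, tail_conv_decomp H H hn2,
        ENNReal.add_div]
      gcongr
      · rw [lintegral_const_mul _ (by fun_prop)]
        simp only [div_eq_mul_inv]
        rw [lintegral_mul_const _ (by fun_prop), two_mul, add_mul]
      · rw [ENNReal.le_div_iff_mul_le (.inl h0) (.inl h1)]
        calc B⁻¹ * tail H (u n) = tail H (u n) / B := by rw [div_eq_mul_inv, mul_comm]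
          _ ≤ _ := ENNReal.div_le_of_le_mul' hn
    calc 2 * (∫⁻ y in Iic A, ENNReal.ofReal (Real.exp (γ * y)) ∂H) + B⁻¹
        = ∫⁻ y, liminf (fun n => f n y) atTop ∂H := by
          simp only [hlim]
          rw [lintegral_add_right _ measurable_const, lintegral_indicator measurableSet_Iic,
            lintegral_const, measure_univ, mul_one, lintegral_const_mul _ (by fun_prop)]
      _ ≤ liminf (fun n => ∫⁻ y, f n y ∂H) atTop := lintegral_liminf_le hfm
      _ ≤ liminf (fun n => tail (convPow H 2) (u n) / tail H (u n)) atTop :=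
          liminf_le_liminf hint
      _ = 2 * m := (hS.comp hu).liminf_eq
  have hlimA : Tendsto (fun A : ℝ => ∫⁻ y in Iic A, ENNReal.ofReal (Real.exp (γ * y)) ∂H) atTop
      (𝓝 m) := by
    rw [hm_def, expMoment_eq_lintegral hH0]
    have h1 := tendsto_measure_Iic_atTop
      (H.withDensity fun y => ENNReal.ofReal (Real.exp (γ * y)))
    rw [withDensity_apply _ MeasurableSet.univ, setLIntegral_univ] at h1
    refine h1.congr fun A => ?_
    rw [withDensity_apply _ measurableSet_Iic]
  have hfin : 2 * m + B⁻¹ ≤ 2 * m := by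
    refine le_of_tendsto ((ENNReal.Tendsto.const_mul hlimA (.inr (by simp))).add_const B⁻¹) ?_
    filter_upwards [eventually_gt_atTop 0] with A hA using key A hA
  have h2m : 2 * m ≠ ⊤ := ENNReal.mul_ne_top (by simp) hm.ne
  have : B⁻¹ ≤ 0 := by
    rw [← ENNReal.add_le_add_iff_left h2m, add_zero]
    exact hfin
  exact hB (ENNReal.inv_eq_zero.1 (le_zero_iff.1 this))

/-- Along the sparse sequence, the tail of `F^{*2}` comes from sums of two large terms. -/
lemma AbsorbsConv.exists_tail_le_jointTail {γ : ℝ} {F : Measure ℝ} (h : AbsorbsConv γ F) :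
    ∃ u : ℕ → ℝ, Tendsto u atTop atTop ∧ ∀ A : ℝ, 0 < A → ∀ᶠ n in atTop,
      tail (convPow F 2) (u n) ≤ 2 * jointTail F F A A (u n) := by
  have := h.prob
  obtain ⟨u, hu, hsp⟩ := h.sparse
  refine ⟨u, hu, fun A hA => ?_⟩
  set E := ENNReal.ofReal (Real.exp (γ * A)) with hE
  -- With `ε (E + 1) ≤ 1/4`, each of the two parts with a summand at most `A` takes at most a
  -- quarter of the tail, leaving at least half to the joint part.
  obtain ⟨ε, hε0, -, hε⟩ := exists_ne_zero_mul_le (C := E + 1)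
    (by simp [hE]) (ε := 4⁻¹) (by simp)
  filter_upwards [hu.eventually (h.negl A hA ε hε0), hsp ε hε0,
    hu.eventually_ge_atTop (A + A)] with n h1 h2 h3
  set W := tail (convPow F 2) (u n) with hW
  have h4 : tail F (u n - A) ≤ 4⁻¹ * W := by
    calc tail F (u n - A) ≤ E * (ε * W) + ε * W := h1.1.trans (by gcongr)
      _ = ε * (E + 1) * W := by ring
      _ ≤ _ := by gcongr
  have h5 : (4⁻¹ : ℝ≥0∞) + 4⁻¹ = 2⁻¹ := by
    rw [show (4 : ℝ≥0∞) = 2 * 2 by norm_num, ENNReal.mul_inv (by simp) (by simp), ← mul_add,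
      ENNReal.inv_two_add_inv_two, mul_one]
  refine le_two_mul_of_le_add_half (tail_ne_top _ _) ?_
  calc W = _ := by rw [hW, convPow_two, tail_conv_decomp F F h3]
    _ ≤ 4⁻¹ * W + 4⁻¹ * W + jointTail F F A A (u n) := by
        gcongr <;> exact (setLIntegral_tail_sub_le F A (u n)).trans h4
    _ = _ := by rw [← add_mul, h5, add_comm]

/-! ### Class membership of random convolutions and of convolution powers -/

/-- Everything reduces to two-sided comparability of the tails of `F^{*τ}` and `F^{*2}`: the lower
bound uses one index `k ≥ 2` charged by `τ`, the upper bound the Kesten condition. -/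
theorem AbsorbsConv.randomConv_mem {γ : ℝ} (hγ : 0 ≤ γ) {F : Measure ℝ} (h : AbsorbsConv γ F)
    {τ : PMF ℕ} (hτ2 : ∃ k : ℕ, 2 ≤ k ∧ τ k ≠ 0) (hτ : KestenCondition F τ) :
    randomConv F τ ∈ (classL γ ∩ classOS) \ classS γ := by
  have := h.prob
  obtain ⟨k, hk2, hk⟩ := hτ2
  set H := randomConv F τ with hH
  have hC : (τ k)⁻¹ ≠ ⊤ := by simpa using hk
  have hWH : ∀ x, tail (convPow F 2) x ≤ (τ k)⁻¹ * tail H x := fun x =>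
    (tail_convPow_mono h.nonneg hk2 x).trans (tail_convPow_le_randomConv F hk x)
  have hFH : ∀ x, tail F x ≤ (τ k)⁻¹ * tail H x := fun x =>
    (tail_le_tail_convPow h.nonneg (by norm_num) x).trans (hWH x)
  obtain ⟨C, hCt, hHW⟩ := h.tail_randomConv_le hτ
  have hH0 : H (Iio 0) = 0 := randomConv_Iio_zero h.nonneg τ
  have hpos : ∀ x, 0 < tail H x := fun x => by
    by_contra h0
    have h1 := hFH x
    rw [nonpos_iff_eq_zero.1 (not_lt.1 h0), mul_zero] at h1
    exact (h.tail_pos x).not_ge h1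
  refine ⟨⟨mem_classL_of_shiftNegl hH0 hpos (h.shiftNegl_randomConv hγ hτ hC hWH), ?_⟩, ?_⟩
  · obtain ⟨K, hK, hK3⟩ := h.absorb
    refine mem_classOS_of_le hH0 hpos (K := C * (C * (K ^ 2 * (τ k)⁻¹))) ?_ fun x => ?_
    · exact ENNReal.mul_ne_top hCt (ENNReal.mul_ne_top hCt
        (ENNReal.mul_ne_top (ENNReal.pow_ne_top hK) hC))
    · calc tail (H.conv H) x ≤ C * tail ((convPow F 2).conv H) x := tail_conv_mono hHW H x
        _ = C * tail (H.conv (convPow F 2)) x := by rw [Measure.conv_comm]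
        _ ≤ C * (C * tail ((convPow F 2).conv (convPow F 2)) x) := by
            gcongr; exact tail_conv_mono hHW _ x
        _ ≤ C * (C * (K ^ 2 * tail (convPow F 2) x)) := by
            gcongr
            rw [← convPow_add]
            exact tail_convPow_add_le_pow hK3 2 x
        _ ≤ C * (C * (K ^ 2 * ((τ k)⁻¹ * tail H x))) := by gcongr; exact hWH x
        _ = _ := by ring
  · obtain ⟨u, hu, hJ⟩ := h.exists_tail_le_jointTail
    refine notMem_classS_of_jointTail hu (B := C * (2 * ((τ k)⁻¹ * (τ k)⁻¹))) ?_ fun A hA => ?_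
    · exact ENNReal.mul_ne_top hCt (ENNReal.mul_ne_top (by simp) (ENNReal.mul_ne_top hC hC))
    · filter_upwards [hJ A hA] with n hn
      calc tail H (u n) ≤ C * tail (convPow F 2) (u n) := hHW _
        _ ≤ C * (2 * jointTail F F A A (u n)) := by gcongr
        _ ≤ C * (2 * ((τ k)⁻¹ * ((τ k)⁻¹ * jointTail H H A A (u n)))) := by
            gcongr; exact jointTail_self_mono hFH A A (u n)
        _ = _ := by ring

theorem AbsorbsConv.convPow_mem {γ : ℝ} (hγ : 0 ≤ γ) {F : Measure ℝ} (h : AbsorbsConv γ F)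
    {k : ℕ} (hk : 2 ≤ k) : convPow F k ∈ (classL γ ∩ classOS) \ classS γ := by
  rw [← randomConv_pure]
  -- For the point mass at `k`, the choice `M = k` makes the Kesten sum vanish, since its weights
  -- start at index `k + 1`.
  refine h.randomConv_mem hγ ⟨k, hk, by simp⟩ fun ε _ _ => ⟨k, fun x _ => ?_⟩
  rw [ENNReal.tsum_eq_zero.2 fun j => ?_]
  · exact zero_le
  · rw [PMF.pure_apply_of_ne _ _ (by omega), zero_mul]

/-! ### Union bounds for the tail of a convolution -/

lemma mul_volume_eq_zero {c : ℝ≥0∞} {s : Set ℝ} (hs : ∀ y, y ∉ s) : c * volume s = 0 := by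
  rw [Set.eq_empty_iff_forall_notMem.2 hs, measure_empty, mul_zero]

/-- If `X + Y > x`, then `X > c` or `Y > d`, for any `c + d ≤ x`. -/
lemma tail_conv_le_add (A B : Measure ℝ) [SFinite A] [SFinite B] {c d x : ℝ} (h : c + d ≤ x) :
    tail (A.conv B) x ≤ (∫⁻ y, tail A (max c (x - y)) ∂B) + ∫⁻ u, tail B (max d (x - u)) ∂A := by
  have m1 : MeasurableSet {p : ℝ × ℝ | c < p.1 ∧ x < p.1 + p.2} := by
    simp only [ofPred_and]
    exact (measurableSet_lt (by fun_prop) (by fun_prop)).inter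
      (measurableSet_lt (by fun_prop) (by fun_prop))
  have m2 : MeasurableSet {p : ℝ × ℝ | d < p.2 ∧ x < p.1 + p.2} := by
    simp only [ofPred_and]
    exact (measurableSet_lt (by fun_prop) (by fun_prop)).inter
      (measurableSet_lt (by fun_prop) (by fun_prop))
  have e1 : (A.prod B) {p | c < p.1 ∧ x < p.1 + p.2} = ∫⁻ y, tail A (max c (x - y)) ∂B := by
    rw [Measure.prod_apply_symm m1]
    refine lintegral_congr fun y => ?_
    rw [tail]
    congr 1
    ext u
    simp [sub_lt_iff_lt_add]
  have e2 : (A.prod B) {p | d < p.2 ∧ x < p.1 + p.2} = ∫⁻ u, tail B (max d (x - u)) ∂A := by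
    rw [Measure.prod_apply m2]
    refine lintegral_congr fun y => ?_
    rw [tail]
    congr 1
    ext u
    simp [sub_lt_iff_lt_add']
  rw [tail_conv_eq_prod, ← e1, ← e2]
  refine (measure_mono fun p hp => ?_).trans (measure_union_le _ _)
  have hp' : x < p.1 + p.2 := hp
  by_cases h1 : c < p.1
  · exact .inl ⟨h1, hp⟩
  · exact .inr ⟨by linarith, hp⟩

lemma tail_conv_self_le (A : Measure ℝ) [SFinite A] (x : ℝ) :
    tail (A.conv A) x ≤ 2 * ∫⁻ y, tail A (max (x / 2) (x - y)) ∂A := by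
  rw [two_mul]
  exact tail_conv_le_add A A (by linarith)

/-! ### Mixtures of uniform distributions on sparse blocks -/

/-- `F₀` has density `κ n` on the block `(a n, 2 a n)` and no mass elsewhere, where the blocks are
sparse and the mass of the block `n + 1` is the density on the block `n`. -/
structure IsBlockLaw (a κ : ℕ → ℝ) (F₀ : Measure ℝ) : Prop where
  prob : IsProbabilityMeasure F₀
  one_lt : 1 < a 0
  step : ∀ n, 8 * a n < a (n + 1)
  density_pos : ∀ n, 0 < κ n
  density_step : ∀ n, κ (n + 1) * a (n + 1) = κ n
  law : F₀ = Measure.sum fun n => ENNReal.ofReal (κ n) • volume.restrict (Ioo (a n) (2 * a n))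

namespace IsBlockLaw

variable {a κ : ℕ → ℝ} {F₀ : Measure ℝ}

lemma pow_le (h : IsBlockLaw a κ F₀) (n : ℕ) : (8 : ℝ) ^ n ≤ a n := by
  induction n with
  | zero => simpa using h.one_lt.le
  | succ n ih => rw [pow_succ]; linarith [h.step n]

lemma one_le (h : IsBlockLaw a κ F₀) (n : ℕ) : 1 ≤ a n :=
  (one_le_pow₀ (by norm_num)).trans (h.pow_le n)

lemma strictMono (h : IsBlockLaw a κ F₀) : StrictMono a :=
  strictMono_nat_of_lt_succ fun n => by linarith [h.step n, h.one_le n]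

lemma tendsto (h : IsBlockLaw a κ F₀) : Tendsto a atTop atTop :=
  tendsto_atTop_mono h.pow_le (tendsto_pow_atTop_atTop_of_one_lt (by norm_num))

lemma eight_mul_le (h : IsBlockLaw a κ F₀) {i n : ℕ} (hi : i < n) : 8 * a i ≤ a n :=
  (h.step i).le.trans (h.strictMono.monotone hi)

lemma density_succ_le (h : IsBlockLaw a κ F₀) (n : ℕ) : κ (n + 1) ≤ κ n / 2 := by
  have h1 := h.density_step n
  have h2 : 2 ≤ a (n + 1) := by linarith [h.step n, h.one_le n]
  nlinarith [h.density_pos (n + 1)]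

lemma density_antitone (h : IsBlockLaw a κ F₀) : Antitone κ :=
  antitone_nat_of_succ_le fun n => by linarith [h.density_succ_le n, h.density_pos n]

lemma measure_eq (h : IsBlockLaw a κ F₀) {s : Set ℝ} (hs : MeasurableSet s) :
    F₀ s = ∑' n, ENNReal.ofReal (κ n) * volume (s ∩ Ioo (a n) (2 * a n)) := by
  rw [h.law, Measure.sum_apply _ hs]
  simp [Measure.restrict_apply hs]

lemma measure_block_le (h : IsBlockLaw a κ F₀) {s : Set ℝ} (hs : MeasurableSet s) (n : ℕ) :
    ENNReal.ofReal (κ n) * volume (s ∩ Ioo (a n) (2 * a n)) ≤ F₀ s := by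
  rw [h.measure_eq hs]
  exact ENNReal.le_tsum (f := fun n => ENNReal.ofReal (κ n) * volume (s ∩ Ioo (a n) (2 * a n))) n

lemma tail_eq_add {u v : ℝ} (huv : u ≤ v) :
    tail F₀ u = F₀ (Ioc u v) + tail F₀ v := by
  rw [tail, tail, ← measure_union _ measurableSet_Ioi, Ioc_union_Ioi_eq_Ioi huv]
  rw [Set.disjoint_left]
  rintro y hy1 hy2
  exact absurd hy1.2 (not_le.2 hy2)

/-- To the right of the blocks before `n` the density never exceeds `κ n`, since the densities
decrease and the blocks are disjoint. -/
lemma tail_le_add (h : IsBlockLaw a κ F₀) {n : ℕ} {u v : ℝ} (huv : u ≤ v)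
    (hn : ∀ i < n, 2 * a i ≤ u) :
    tail F₀ u ≤ tail F₀ v + ENNReal.ofReal (κ n) * ENNReal.ofReal (v - u) := by
  rw [tail_eq_add huv, add_comm]
  gcongr
  rw [h.measure_eq measurableSet_Ioc]
  calc ∑' i, ENNReal.ofReal (κ i) * volume (Ioc u v ∩ Ioo (a i) (2 * a i))
      ≤ ∑' i, ENNReal.ofReal (κ n) * volume (Ioc u v ∩ Ioo (a i) (2 * a i)) := by
        refine ENNReal.tsum_le_tsum fun i => ?_
        rcases lt_or_ge i n with hi | hi
        · have : Ioc u v ∩ Ioo (a i) (2 * a i) = ∅ := by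
            rw [Set.eq_empty_iff_forall_notMem]
            rintro y ⟨hy1, hy2⟩
            linarith [hy1.1, hy2.2, hn i hi]
          simp [this]
        · gcongr
          exact h.density_antitone hi
    _ = ENNReal.ofReal (κ n) * volume (⋃ i, Ioc u v ∩ Ioo (a i) (2 * a i)) := by
        rw [ENNReal.tsum_mul_left, measure_iUnion _ fun i =>
          measurableSet_Ioc.inter measurableSet_Ioo]
        intro i j hij
        wlog hlt : i < j generalizing i j
        · exact (this hij.symm (lt_of_le_of_ne (not_lt.1 hlt) hij.symm)).symm
        rw [Function.onFun, Set.disjoint_left]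
        rintro y hy1 hy2
        linarith [hy1.2.2, hy2.2.1, h.eight_mul_le hlt, h.one_le i]
    _ ≤ ENNReal.ofReal (κ n) * volume (Ioc u v) := by
        gcongr
        exact iUnion_subset fun i => inter_subset_left
    _ = _ := by rw [Real.volume_Ioc]

/-- Block `n + 1` alone, whose mass is `κ n`, lies to the right of `x`. -/
lemma density_le_tail (h : IsBlockLaw a κ F₀) {n : ℕ} {x : ℝ} (hx : x ≤ a (n + 1)) :
    ENNReal.ofReal (κ n) ≤ tail F₀ x := by
  refine le_trans ?_ (h.measure_block_le measurableSet_Ioi (n + 1))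
  rw [inter_eq_right.2 fun y hy => mem_Ioi.2 (hx.trans_lt hy.1), Real.volume_Ioo,
    ← ENNReal.ofReal_mul (h.density_pos _).le, show 2 * a (n + 1) - a (n + 1) = a (n + 1) by ring,
    h.density_step]

lemma tail_pos (h : IsBlockLaw a κ F₀) (x : ℝ) : 0 < tail F₀ x := by
  obtain ⟨n, hn⟩ := (h.tendsto.eventually_ge_atTop x).exists
  exact (ENNReal.ofReal_pos.2 (h.density_pos n)).trans_le
    (h.density_le_tail (hn.trans (h.strictMono.monotone n.le_succ)))

lemma tail_one (h : IsBlockLaw a κ F₀) : tail F₀ 1 = 1 := by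
  have := h.prob
  rw [tail, ← compl_Iic, prob_compl_eq_one_iff measurableSet_Iic, h.measure_eq measurableSet_Iic,
    ENNReal.tsum_eq_zero]
  intro n
  refine mul_volume_eq_zero ?_
  rintro y ⟨hy1, hy2⟩
  exact absurd (h.one_le n) (not_le.2 (hy2.1.trans_le hy1))

lemma tail_of_le_one (h : IsBlockLaw a κ F₀) {x : ℝ} (hx : x ≤ 1) : tail F₀ x = 1 := by
  have := h.prob
  exact le_antisymm (tail_le_one _ _) (h.tail_one ▸ tail_antitone F₀ hx)

lemma Iic_one (h : IsBlockLaw a κ F₀) : F₀ (Iic 1) = 0 := by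
  have := h.prob
  have h1 := h.tail_one
  rwa [tail, ← compl_Iic, prob_compl_eq_one_iff measurableSet_Iic] at h1

lemma Iio_zero (h : IsBlockLaw a κ F₀) : F₀ (Iio 0) = 0 :=
  measure_mono_null (fun y hy => mem_Iic.2 (by linarith [mem_Iio.1 hy])) h.Iic_one

lemma le_tail_of_block (h : IsBlockLaw a κ F₀) {n : ℕ} {u v : ℝ} (hu : a n ≤ u) (huv : u ≤ v)
    (hv : v ≤ 2 * a n) :
    tail F₀ v + ENNReal.ofReal (κ n) * ENNReal.ofReal (v - u) ≤ tail F₀ u := by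
  rw [tail_eq_add huv, add_comm]
  gcongr
  refine le_trans ?_ (h.measure_block_le measurableSet_Ioc n)
  gcongr
  rw [← Real.volume_Ioo]
  exact measure_mono fun y hy =>
    ⟨⟨hy.1, hy.2.le⟩, by linarith [hy.1, h.one_le n], by linarith [hy.2]⟩

/-- Beyond `2 a n` the blocks have masses `κ n`, `κ (n + 1)`, and so on, each at most half of the
one before. -/
lemma tail_two_mul_le (h : IsBlockLaw a κ F₀) (n : ℕ) :
    tail F₀ (2 * a n) ≤ 2 * ENNReal.ofReal (κ n) := by
  rw [tail, h.measure_eq measurableSet_Ioi, ← Summable.sum_add_tsum_nat_add' (k := n + 1)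
    (f := fun i => ENNReal.ofReal (κ i) * volume (Ioi (2 * a n) ∩ Ioo (a i) (2 * a i)))
    ENNReal.summable, Finset.sum_eq_zero, zero_add]
  · have hκ : ∀ j, κ (n + j) ≤ κ n * 2⁻¹ ^ j := fun j => by
      induction j with
      | zero => simp
      | succ j ih =>
        have := h.density_succ_le (n + j)
        rw [pow_succ, ← add_assoc]
        linarith
    calc ∑' j, ENNReal.ofReal (κ (j + (n + 1))) *
          volume (Ioi (2 * a n) ∩ Ioo (a (j + (n + 1))) (2 * a (j + (n + 1))))
        ≤ ∑' j : ℕ, ENNReal.ofReal (κ n) * (2⁻¹) ^ j := by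
          refine ENNReal.tsum_le_tsum fun j => ?_
          calc _ ≤ ENNReal.ofReal (κ (n + j + 1)) *
                volume (Ioo (a (n + j + 1)) (2 * a (n + j + 1))) := by
                rw [show j + (n + 1) = n + j + 1 by ring]
                gcongr
                exact inter_subset_right
            _ = ENNReal.ofReal (κ (n + j)) := by
                rw [Real.volume_Ioo, ← ENNReal.ofReal_mul (h.density_pos _).le, two_mul,
                  add_sub_cancel_right, h.density_step]
            _ ≤ ENNReal.ofReal (κ n * 2⁻¹ ^ j) := ENNReal.ofReal_le_ofReal (hκ j)
            _ = _ := by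
                rw [ENNReal.ofReal_mul (h.density_pos n).le, ENNReal.ofReal_pow (by norm_num),
                  ENNReal.ofReal_inv_of_pos (by norm_num), ENNReal.ofReal_ofNat]
      _ = 2 * ENNReal.ofReal (κ n) := by
          rw [ENNReal.tsum_mul_left, ENNReal.tsum_geometric, ENNReal.one_sub_inv_two, inv_inv,
            mul_comm]
  · intro i hi
    refine mul_volume_eq_zero ?_
    rintro y ⟨hy1, hy2⟩
    have := h.strictMono.monotone (Nat.lt_succ_iff.1 (Finset.mem_range.1 hi))
    linarith [mem_Ioi.1 hy1, hy2.2]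

lemma tail_half (h : IsBlockLaw a κ F₀) {n : ℕ} :
    tail F₀ (a n / 2) = tail F₀ (a n) := by
  rw [tail_eq_add (v := a n) (by linarith [h.one_le n]), h.measure_eq measurableSet_Ioc,
    ENNReal.tsum_eq_zero.2 fun i => ?_, zero_add]
  refine mul_volume_eq_zero ?_
  rintro y ⟨hy1, hy2⟩
  rcases lt_or_ge i n with hi | hi
  · linarith [hy1.1, hy2.2, h.eight_mul_le hi, h.one_le i]
  · linarith [hy1.2, hy2.1, h.strictMono.monotone hi]

/-- The index of the block that governs the tail on the scale of `x`. -/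
lemma exists_index (h : IsBlockLaw a κ F₀) (x : ℝ) :
    ∃ n, x ≤ 6 * a n ∧ ∀ i < n, 6 * a i < x := by
  have hex : ∃ n, x ≤ 6 * a n := by
    obtain ⟨n, hn⟩ := (h.tendsto.eventually_ge_atTop x).exists
    exact ⟨n, by linarith [h.one_le n]⟩
  classical
  exact ⟨Nat.find hex, Nat.find_spec hex, fun i hi => not_le.1 (Nat.find_min hex hi)⟩

/-- On `[x / 3, ∞)`, the tail is Lipschitz with a constant at most its value at `x`. -/
lemma tail_le_tail_add (h : IsBlockLaw a κ F₀) {x y s : ℝ} (hxy : x / 3 ≤ y) (hs : 0 ≤ s) :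
    tail F₀ y ≤ tail F₀ (y + s) + ENNReal.ofReal s * tail F₀ x := by
  -- The factor `6` serves twice: earlier blocks end before `x / 3`, and `6 a n < a (n + 1)` leaves
  -- the whole block `n + 1` beyond `x`.
  obtain ⟨n, hn, hi⟩ := h.exists_index x
  refine (h.tail_le_add (v := y + s) (n := n) (by linarith) fun i hin => ?_).trans ?_
  · linarith [hi i hin]
  · rw [add_sub_cancel_left, mul_comm]
    gcongr
    exact h.density_le_tail (by linarith [h.step n, h.one_le n])

/-! ### Convolution powers of a block law -/

/-- One summand exceeds `x / 2`; by the Lipschitz bound, lowering the level by the other summand `y`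
costs at most a factor `1 + y`, which has finite mean. -/
lemma exists_convPow_two_le (h : IsBlockLaw a κ F₀) (hm : ∫⁻ y, ENNReal.ofReal y ∂F₀ ≠ ⊤) :
    ∃ K : ℝ≥0∞, K ≠ ⊤ ∧ ∀ x, tail (convPow F₀ 2) x ≤ K * tail F₀ x := by
  have := h.prob
  refine ⟨2 * (1 + ∫⁻ y, ENNReal.ofReal y ∂F₀), ENNReal.mul_ne_top (by simp) (by simp [hm]),
    fun x => ?_⟩
  rcases lt_or_ge x 0 with hx | hx
  · rw [tail_of_neg h.Iio_zero hx, mul_one]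
    refine (tail_le_one _ _).trans ?_
    rw [mul_add]
    exact le_add_right (by norm_num)
  · rw [convPow_two, mul_assoc]
    refine (tail_conv_self_le F₀ x).trans ?_
    gcongr
    calc ∫⁻ y, tail F₀ (max (x / 2) (x - y)) ∂F₀
        ≤ ∫⁻ y, (1 + ENNReal.ofReal y) * tail F₀ x ∂F₀ := by
          refine lintegral_mono_ae ?_
          filter_upwards [ae_nonneg_of_Iio h.Iio_zero] with y hy
          refine (h.tail_le_tail_add (x := x) (s := y) ?_ hy).trans ?_
          · exact le_trans (by linarith) (le_max_left _ _)
          · rw [add_mul, one_mul]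
            gcongr
            refine tail_antitone F₀ ?_
            linarith [le_max_right (x / 2) (x - y)]
      _ = _ := by
          rw [lintegral_mul_const _ (by fun_prop), lintegral_add_left (by fun_prop)]
          simp

theorem convPow_mem (h : IsBlockLaw a κ F₀) (hm : ∫⁻ y, ENNReal.ofReal y ∂F₀ ≠ ⊤) {k : ℕ}
    (hk : 1 ≤ k) : convPow F₀ k ∈ classOS \ classL 0 := by
  have := h.prob
  obtain ⟨K, hK, hK2⟩ := h.exists_convPow_two_le hm
  have hpow : ∀ j x, tail (convPow F₀ (1 + j)) x ≤ K ^ j * tail F₀ x := fun j x => by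
    have := tail_convPow_add_le_pow (F := F₀) (K := K) (i := 1)
      (fun x => by rw [convPow_one]; exact hK2 x) j x
    rwa [convPow_one] at this
  have hle : ∀ x, tail F₀ x ≤ tail (convPow F₀ k) x := tail_le_tail_convPow h.Iio_zero hk
  have hpos : ∀ x, 0 < tail (convPow F₀ k) x := fun x => (h.tail_pos x).trans_le (hle x)
  refine ⟨mem_classOS_of_le (convPow_Iio_zero h.Iio_zero k) hpos (K := K ^ (k + k - 1))
    (ENNReal.pow_ne_top hK) fun x => ?_, fun hL => ?_⟩
  · rw [← convPow_add, show k + k = 1 + (k + k - 1) by omega]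
    refine (hpow _ x).trans ?_
    rw [show 1 + (k + k - 1) - 1 = k + k - 1 by omega]
    gcongr
    exact hle x
  · obtain ⟨j, rfl⟩ := Nat.exists_eq_add_of_le hk
    obtain ⟨A, hA, hA0⟩ : ∃ A : ℝ, 0 < convPow F₀ j (Iic A) ∧ 0 ≤ A := by
      have h1 := tendsto_measure_Iic_atTop (convPow F₀ j)
      rw [measure_univ] at h1
      exact ((h1.eventually_const_lt one_pos).and (eventually_ge_atTop 0)).exists
    set q := convPow F₀ j (Iic A) with hq
    -- With probability at least `q` the other `j` summands total at most `A`. The unit step below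
    -- `2 a n` then lies inside block `n` and gains `κ n`, a fixed proportion of the tail.
    have hinc : ∀ᶠ n in atTop, 1 + q * (2 * K ^ j)⁻¹ ≤
        tail (convPow F₀ (1 + j)) (2 * a n - 1) / tail (convPow F₀ (1 + j)) (2 * a n) := by
      filter_upwards [h.tendsto.eventually_ge_atTop (A + 1)] with n hn
      have h0 := (hpos (2 * a n)).ne'
      have h1 := tail_ne_top (convPow F₀ (1 + j)) (2 * a n)
      rw [ENNReal.le_div_iff_mul_le (.inl h0) (.inl h1)]
      have hκ : (2 * K ^ j)⁻¹ * tail (convPow F₀ (1 + j)) (2 * a n) ≤ ENNReal.ofReal (κ n) := by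
        rw [mul_comm, ← div_eq_mul_inv]
        refine ENNReal.div_le_of_le_mul' ?_
        calc _ ≤ K ^ j * tail F₀ (2 * a n) := hpow j _
          _ ≤ K ^ j * (2 * ENNReal.ofReal (κ n)) := by gcongr; exact h.tail_two_mul_le n
          _ = _ := by ring
      calc (1 + q * (2 * K ^ j)⁻¹) * tail (convPow F₀ (1 + j)) (2 * a n)
          = tail (convPow F₀ (1 + j)) (2 * a n)
            + q * ((2 * K ^ j)⁻¹ * tail (convPow F₀ (1 + j)) (2 * a n)) := by ring
        _ ≤ tail (convPow F₀ (1 + j)) (2 * a n) + q * ENNReal.ofReal (κ n) := by gcongr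
        _ = ∫⁻ y, (tail F₀ (2 * a n - y) + (Iic A).indicator (fun _ => ENNReal.ofReal (κ n)) y)
            ∂(convPow F₀ j) := by
            rw [lintegral_add_left (by fun_prop), lintegral_indicator measurableSet_Iic,
              setLIntegral_const, convPow_add, convPow_one, tail_conv, mul_comm q]
        _ ≤ ∫⁻ y, tail F₀ (2 * a n - 1 - y) ∂(convPow F₀ j) := by
            refine lintegral_mono_ae ?_
            filter_upwards [ae_nonneg_of_Iio (convPow_Iio_zero h.Iio_zero j)] with y hy
            by_cases hyA : y ∈ Iic A
            · have hyA' := mem_Iic.1 hyA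
              rw [indicator_of_mem hyA]
              have := h.le_tail_of_block (n := n) (u := 2 * a n - 1 - y) (v := 2 * a n - y)
                (by linarith) (by linarith) (by linarith)
              rwa [show 2 * a n - y - (2 * a n - 1 - y) = 1 by ring, ENNReal.ofReal_one,
                mul_one] at this
            · rw [indicator_of_notMem hyA, add_zero]
              exact tail_antitone F₀ (by linarith)
        _ = _ := by rw [convPow_add, convPow_one, tail_conv]
    have hu : Tendsto (fun n => 2 * a n) atTop atTop := h.tendsto.const_mul_atTop (by norm_num)
    have hlim := ge_of_tendsto ((hL.2 1).comp hu) hinc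
    rw [zero_mul, Real.exp_zero, ENNReal.ofReal_one] at hlim
    have h2 : q * (2 * K ^ j)⁻¹ ≤ 0 := by
      rw [← ENNReal.add_le_add_iff_left (a := 1) (by simp), add_zero]
      exact hlim
    rcases mul_eq_zero.1 (le_zero_iff.1 h2) with h3 | h3
    · exact hA.ne' h3
    · exact ENNReal.mul_ne_top (by simp) (ENNReal.pow_ne_top hK) (ENNReal.inv_eq_zero.1 h3)

end IsBlockLaw

/-! ### The exponential transform -/

lemma lintegral_Ioo_exp {γ : ℝ} (hγ : 0 < γ) {x z : ℝ} (h : x ≤ z) :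
    ∫⁻ y in Ioo x z, ENNReal.ofReal (γ * Real.exp (-γ * y)) =
      ENNReal.ofReal (Real.exp (-γ * x) - Real.exp (-γ * z)) := by
  have hint : IntervalIntegrable (fun y => γ * Real.exp (-γ * y)) volume x z :=
    Continuous.intervalIntegrable (by fun_prop) _ _
  have hftc : ∫ y in x..z, γ * Real.exp (-γ * y) = Real.exp (-γ * x) - Real.exp (-γ * z) := by
    rw [intervalIntegral.integral_eq_sub_of_hasDerivAt (f := fun y => -Real.exp (-γ * y))
      (fun y _ => ?_) hint]
    · ring
    · have h1 : HasDerivAt (fun y : ℝ => -γ * y) (-γ) y := by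
        simpa using (hasDerivAt_id y).const_mul (-γ)
      have h2 : HasDerivAt (fun y : ℝ => -Real.exp (-γ * y)) _ y := h1.exp.fun_neg
      exact h2.congr_deriv (by ring)
  rw [← hftc, intervalIntegral.integral_of_le h, integral_Ioc_eq_integral_Ioo,
    ofReal_integral_eq_lintegral_ofReal]
  · exact (hint.1).mono_set Ioo_subset_Ioc_self
  · exact Eventually.of_forall fun y => by positivity

lemma lintegral_mul_tail {g : ℝ → ℝ≥0∞} (hg : Measurable g) (A : Measure ℝ) [SFinite A] (x : ℝ) :
    ∫⁻ y in Ioi x, g y * tail A y = ∫⁻ z, (∫⁻ y in Ioo x z, g y) ∂A := by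
  have h1 : ∀ y, g y * tail A y = ∫⁻ z, (Ioi y).indicator (fun _ => g y) z ∂A := fun y => by
    rw [lintegral_indicator measurableSet_Ioi, setLIntegral_const, tail]
  have hm : Measurable fun p : ℝ × ℝ => (Ioi p.1).indicator (fun _ => g p.1) p.2 := by
    have : MeasurableSet {p : ℝ × ℝ | p.1 < p.2} := measurableSet_lt (by fun_prop) (by fun_prop)
    convert (hg.comp measurable_fst).indicator this using 1
    ext p
    by_cases hp : p.1 < p.2 <;> simp [indicator, hp]
  simp only [h1]
  rw [lintegral_lintegral_swap hm.aemeasurable]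
  refine lintegral_congr fun z => ?_
  rw [← lintegral_indicator measurableSet_Ioi, ← lintegral_indicator measurableSet_Ioo]
  refine lintegral_congr fun y => ?_
  by_cases h1 : x < y <;> by_cases h2 : y < z <;> simp [indicator, h1, h2]

/-- The transform of `F₀`, given by its density with respect to Lebesgue measure and `F₀`. -/
noncomputable def expTransform (γ : ℝ) (F₀ : Measure ℝ) : Measure ℝ :=
  (volume.restrict (Ioi 0)).withDensity
      (fun y => ENNReal.ofReal (γ * Real.exp (-γ * y)) * tail F₀ y) +
    F₀.withDensity fun y => ENNReal.ofReal (Real.exp (-γ * y))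

/-- By Fubini each `z > x` receives the integral of `γ e^{-γ y}` over `(x, z)` plus `e^{-γ z}`,
which is `e^{-γ x}`. -/
lemma tail_expTransform {γ : ℝ} (hγ : 0 < γ) {F₀ : Measure ℝ} [IsProbabilityMeasure F₀] {x : ℝ}
    (hx : 0 ≤ x) :
    tail (expTransform γ F₀) x = ENNReal.ofReal (Real.exp (-γ * x)) * tail F₀ x := by
  rw [tail, expTransform, Measure.add_apply, withDensity_apply _ measurableSet_Ioi,
    withDensity_apply _ measurableSet_Ioi, Measure.restrict_restrict measurableSet_Ioi,
    Ioi_inter_Ioi, max_eq_left hx, lintegral_mul_tail (by fun_prop),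
    ← lintegral_indicator measurableSet_Ioi, ← lintegral_add_right _
      (Measurable.indicator (by fun_prop) measurableSet_Ioi), tail,
    ← setLIntegral_const, ← lintegral_indicator measurableSet_Ioi]
  refine lintegral_congr fun z => ?_
  by_cases hz : x < z
  · rw [indicator_of_mem (by exact hz), indicator_of_mem (by exact hz), lintegral_Ioo_exp hγ hz.le,
      ← ENNReal.ofReal_add (sub_nonneg.2 (Real.exp_le_exp.2 (by nlinarith))) (by positivity),
      sub_add_cancel]
  · rw [indicator_of_notMem (by exact hz), indicator_of_notMem (by exact hz), add_zero,
      Ioo_eq_empty hz]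
    simp

/-- Tails determine a law. The explicit form gives access to integrals against `F` and to a lower
bound for its absolutely continuous part. -/
lemma IsExpTransform.eq {γ : ℝ} (hγ : 0 < γ) {F₀ F : Measure ℝ} [IsProbabilityMeasure F₀]
    (h₀ : F₀ (Iic 0) = 0) (h : IsExpTransform γ F₀ F) : F = expTransform γ F₀ := by
  have := h.1
  have htail0 : tail F₀ 0 = 1 := by
    rw [tail, ← compl_Iic, prob_compl_eq_one_iff measurableSet_Iic, h₀]
  have hnull : expTransform γ F₀ (Iic 0) = 0 := by
    rw [expTransform, Measure.add_apply, withDensity_apply _ measurableSet_Iic,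
      withDensity_apply _ measurableSet_Iic, Measure.restrict_restrict measurableSet_Iic,
      Measure.restrict_eq_zero.2 h₀, Iic_inter_Ioi, Ioc_self]
    simp
  have htail : ∀ x, tail F x = tail (expTransform γ F₀) x := fun x => by
    rw [h.2]
    split_ifs with hx
    · have h1 : tail (expTransform γ F₀) x = tail (expTransform γ F₀) 0 := by
        refine le_antisymm ?_ (tail_antitone _ hx.le)
        calc tail (expTransform γ F₀) x
            ≤ expTransform γ F₀ (Iic 0) + tail (expTransform γ F₀) 0 := by
              refine (measure_mono fun y _ => ?_).trans (measure_union_le _ _)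
              exact le_or_gt y 0
          _ = _ := by rw [hnull, zero_add]
      rw [h1, tail_expTransform hγ le_rfl, htail0]
      simp
    · rw [tail_expTransform hγ (not_lt.1 hx)]
  refine Measure.ext_of_generateFrom_of_iUnion (range Ioi) (fun n : ℕ => Ioi (-(n : ℝ)))
    (BorelSpace.measurable_eq.trans (borel_eq_generateFrom_Ioi ℝ)) isPiSystem_Ioi ?_
    (fun n => ⟨_, rfl⟩) (fun n => measure_ne_top _ _) ?_
  · refine eq_univ_of_forall fun y => ?_
    obtain ⟨n, hn⟩ := exists_nat_gt (-y)
    exact mem_iUnion.2 ⟨n, by rw [mem_Ioi]; linarith⟩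
  · rintro _ ⟨x, rfl⟩
    exact htail x

lemma lintegral_expTransform {γ : ℝ} {F₀ : Measure ℝ} [IsProbabilityMeasure F₀] {f : ℝ → ℝ≥0∞}
    (hf : Measurable f) :
    ∫⁻ y, f y ∂(expTransform γ F₀) =
      (∫⁻ y in Ioi 0, ENNReal.ofReal (γ * Real.exp (-γ * y)) * tail F₀ y * f y) +
        ∫⁻ y, ENNReal.ofReal (Real.exp (-γ * y)) * f y ∂F₀ := by
  rw [expTransform, lintegral_add_measure, lintegral_withDensity_eq_lintegral_mul _ (by fun_prop) hf,
    lintegral_withDensity_eq_lintegral_mul _ (by fun_prop) hf]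
  rfl

/-- The exponentially weighted moments of the transform are controlled by moments of `F₀`. -/
lemma lintegral_exp_mul_expTransform_le {γ : ℝ} (hγ : 0 < γ) {F₀ : Measure ℝ}
    [IsProbabilityMeasure F₀] {φ : ℝ → ℝ≥0∞} (hφ : Monotone φ) :
    ∫⁻ y, φ y * ENNReal.ofReal (Real.exp (γ * y)) ∂(expTransform γ F₀) ≤
      ENNReal.ofReal γ * (∫⁻ y, ENNReal.ofReal y * φ y ∂F₀) + ∫⁻ y, φ y ∂F₀ := by
  have hφm := hφ.measurable
  have hexp : ∀ y : ℝ, ENNReal.ofReal (Real.exp (-γ * y)) * ENNReal.ofReal (Real.exp (γ * y)) = 1 :=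
    fun y => by
      rw [← ENNReal.ofReal_mul (by positivity), ← Real.exp_add]
      simp
  rw [lintegral_expTransform (by fun_prop)]
  refine add_le_add (le_of_eq_of_le (b := ENNReal.ofReal γ * ∫⁻ y in Ioi 0, φ y * tail F₀ y) ?_ ?_)
    (le_of_eq ?_)
  · rw [← lintegral_const_mul _ (by fun_prop)]
    refine lintegral_congr fun y => ?_
    rw [ENNReal.ofReal_mul hγ.le]
    calc _ = ENNReal.ofReal γ * (φ y * tail F₀ y) * (ENNReal.ofReal (Real.exp (-γ * y)) *
          ENNReal.ofReal (Real.exp (γ * y))) := by ring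
      _ = _ := by rw [hexp, mul_one]
  -- The tail of `F₀` becomes an integral of `φ` over `(0, z)`, at most `z φ(z)` by monotonicity;
  -- this is the extra power of `y` in the moment.
  · rw [lintegral_mul_tail hφm]
    refine mul_le_mul' le_rfl (lintegral_mono fun z => ?_)
    calc ∫⁻ y in Ioo 0 z, φ y ≤ ∫⁻ _ in Ioo 0 z, φ z :=
          setLIntegral_mono measurable_const fun y hy => hφ hy.2.le
      _ = _ := by rw [setLIntegral_const, Real.volume_Ioo, sub_zero, mul_comm]
  · refine lintegral_congr fun y => ?_
    calc _ = φ y * (ENNReal.ofReal (Real.exp (-γ * y)) * ENNReal.ofReal (Real.exp (γ * y))) := by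
          ring
      _ = _ := by rw [hexp, mul_one]

/-! ### The transform of a block law -/

lemma IsExpTransform.tail_eq {γ : ℝ} {F₀ F : Measure ℝ} (hF : IsExpTransform γ F₀ F) {x : ℝ}
    (hx : 0 ≤ x) : tail F x = ENNReal.ofReal (Real.exp (-γ * x)) * tail F₀ x := by
  rw [hF.2, if_neg (not_lt.2 hx)]

lemma IsExpTransform.tail_neg {γ : ℝ} {F₀ F : Measure ℝ} (hF : IsExpTransform γ F₀ F) {x : ℝ}
    (hx : x < 0) : tail F x = 1 := by
  rw [hF.2, if_pos hx]

/-- Shifting the tail of the transform amounts to shifting the tail of `F₀`. -/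
lemma IsExpTransform.tail_sub {γ : ℝ} {F₀ F : Measure ℝ} (hF : IsExpTransform γ F₀ F) {t x : ℝ}
    (hx : t ≤ x) : tail F (x - t) = ENNReal.ofReal (Real.exp (γ * t)) *
      (ENNReal.ofReal (Real.exp (-γ * x)) * tail F₀ (x - t)) := by
  rw [hF.tail_eq (by linarith), ← mul_assoc, ← ENNReal.ofReal_mul (by positivity), ← Real.exp_add]
  congr 4
  ring

/-- For `t > 0` the shift of the tail of the transform is at least multiplicative. -/
lemma IsExpTransform.exp_mul_tail_le {γ : ℝ} {F₀ F : Measure ℝ} (hF : IsExpTransform γ F₀ F)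
    {t x : ℝ} (ht : 0 ≤ t) (hx : t ≤ x) :
    ENNReal.ofReal (Real.exp (γ * t)) * tail F x ≤ tail F (x - t) := by
  rw [hF.tail_sub hx, hF.tail_eq (ht.trans hx)]
  gcongr
  exact tail_antitone F₀ (by linarith)

namespace IsBlockLaw

variable {a κ : ℕ → ℝ} {F₀ F : Measure ℝ} {γ : ℝ}

lemma transform_Iio_zero (h : IsBlockLaw a κ F₀) (hF : IsExpTransform γ F₀ F) : F (Iio 0) = 0 := by
  have := hF.1
  have h1 : tail F 0 = 1 := by
    rw [hF.tail_eq le_rfl, h.tail_of_le_one zero_le_one]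
    simp
  rw [tail, ← compl_Iic, prob_compl_eq_one_iff measurableSet_Iic] at h1
  exact measure_mono_null Iio_subset_Iic_self h1

lemma transform_tail_pos (h : IsBlockLaw a κ F₀) (hF : IsExpTransform γ F₀ F) (x : ℝ) :
    0 < tail F x := by
  rcases lt_or_ge x 0 with hx | hx
  · rw [hF.tail_neg hx]; exact one_pos
  · rw [hF.tail_eq hx]
    exact ENNReal.mul_pos (by simp [Real.exp_pos]) (h.tail_pos x).ne'

lemma lintegral_exp_mul_transform_le (h : IsBlockLaw a κ F₀) (hγ : 0 < γ)
    (hF : IsExpTransform γ F₀ F) {φ : ℝ → ℝ≥0∞} (hφ : Monotone φ) :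
    ∫⁻ y, φ y * ENNReal.ofReal (Real.exp (γ * y)) ∂F ≤
      ENNReal.ofReal γ * (∫⁻ y, ENNReal.ofReal y * φ y ∂F₀) + ∫⁻ y, φ y ∂F₀ := by
  have := h.prob
  rw [hF.eq hγ (measure_mono_null (Iic_subset_Iic.2 zero_le_one) h.Iic_one)]
  exact lintegral_exp_mul_expTransform_le hγ hφ

lemma ae_one_lt (h : IsBlockLaw a κ F₀) : ∀ᵐ y ∂F₀, 1 < y := by
  rw [ae_iff]
  convert h.Iic_one using 2
  ext; simp

lemma mean_ne_top (h : IsBlockLaw a κ F₀) (hm : ∫⁻ y, ENNReal.ofReal (y * √y) ∂F₀ ≠ ⊤) :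
    ∫⁻ y, ENNReal.ofReal y ∂F₀ ≠ ⊤ := by
  refine ne_top_of_le_ne_top hm (lintegral_mono_ae ?_)
  filter_upwards [h.ae_one_lt] with y hy
  refine ENNReal.ofReal_le_ofReal ?_
  have : 1 ≤ √y := Real.one_le_sqrt.2 hy.le
  nlinarith

lemma expMoment_transform_lt_top (h : IsBlockLaw a κ F₀) (hγ : 0 < γ)
    (hF : IsExpTransform γ F₀ F) (hm : ∫⁻ y, ENNReal.ofReal (y * √y) ∂F₀ ≠ ⊤) :
    expMoment γ F < ⊤ := by
  have := h.prob
  rw [expMoment_eq_lintegral (h.transform_Iio_zero hF)]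
  have h1 := h.lintegral_exp_mul_transform_le hγ hF (φ := fun _ => 1) monotone_const
  simp only [one_mul, mul_one, lintegral_one, measure_univ] at h1
  exact h1.trans_lt (ENNReal.add_lt_top.2
    ⟨ENNReal.mul_lt_top (by simp) (h.mean_ne_top hm).lt_top, by simp⟩)

lemma sqrt_moment_ne_top (h : IsBlockLaw a κ F₀) (hγ : 0 < γ)
    (hF : IsExpTransform γ F₀ F) (hm : ∫⁻ y, ENNReal.ofReal (y * √y) ∂F₀ ≠ ⊤) :
    ∫⁻ y, ENNReal.ofReal √y * ENNReal.ofReal (Real.exp (γ * y)) ∂F ≠ ⊤ := by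
  have h1 := h.lintegral_exp_mul_transform_le hγ hF (φ := fun y => ENNReal.ofReal √y)
    fun x y hxy => ENNReal.ofReal_le_ofReal (Real.sqrt_le_sqrt hxy)
  refine ne_top_of_le_ne_top (ENNReal.add_ne_top.2 ⟨ENNReal.mul_ne_top (by simp) ?_, ?_⟩) h1
  · refine ne_top_of_le_ne_top hm (lintegral_mono_ae ?_)
    filter_upwards [h.ae_one_lt] with y hy
    rw [ENNReal.ofReal_mul (by linarith)]
  · refine ne_top_of_le_ne_top hm (lintegral_mono_ae ?_)
    filter_upwards [h.ae_one_lt] with y hy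
    exact ENNReal.ofReal_le_ofReal (by nlinarith [Real.sqrt_nonneg y])

/-- The Lipschitz bound for `F₀` moves the level up by `z`, from at least `x / 3` to at least `x -
y`. The exponential factors are then redistributed. -/
lemma transform_tail_max_le (h : IsBlockLaw a κ F₀) (hγ : 0 < γ) (hF : IsExpTransform γ F₀ F)
    {x y z : ℝ} (hx : 0 ≤ x) (hz : 0 ≤ z) :
    tail F (max (x / 3) (x - (y + z))) ≤
      ENNReal.ofReal (Real.exp (γ * z)) * tail F (x - y) +
        ENNReal.ofReal z * ENNReal.ofReal (Real.exp (γ * (y + z))) * tail F x := by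
  have := hF.1
  set M := max (x / 3) (x - (y + z)) with hM
  have hM1 : x / 3 ≤ M := le_max_left _ _
  have hM2 : x - (y + z) ≤ M := le_max_right _ _
  rcases lt_or_ge (x - y) 0 with hxy | hxy
  · refine le_add_right ((tail_le_one F M).trans ?_)
    rw [hF.tail_neg hxy, mul_one, ENNReal.one_le_ofReal, Real.one_le_exp_iff]
    positivity
  · rw [hF.tail_eq (by linarith), hF.tail_eq hxy, hF.tail_eq hx]
    have hKI := h.tail_le_tail_add hM1 hz
    have hexp : ENNReal.ofReal (Real.exp (-γ * M)) ≤ ENNReal.ofReal (Real.exp (-γ * (x - (y + z)))) :=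
      ENNReal.ofReal_le_ofReal (Real.exp_le_exp.2 (by nlinarith))
    calc ENNReal.ofReal (Real.exp (-γ * M)) * tail F₀ M
        ≤ ENNReal.ofReal (Real.exp (-γ * (x - (y + z)))) *
            (tail F₀ (x - y) + ENNReal.ofReal z * tail F₀ x) := by
          gcongr
          refine hKI.trans ?_
          gcongr
          exact tail_antitone F₀ (by linarith)
      _ = _ := by
          rw [mul_add]
          congr 1
          · rw [← mul_assoc, ← ENNReal.ofReal_mul (by positivity), ← Real.exp_add]
            congr 3; ring
          · have : ENNReal.ofReal (Real.exp (-γ * (x - (y + z)))) =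
                ENNReal.ofReal (Real.exp (γ * (y + z))) * ENNReal.ofReal (Real.exp (-γ * x)) := by
              rw [← ENNReal.ofReal_mul (by positivity), ← Real.exp_add]
              congr 2; ring
            rw [this]; ring

/-- The Lipschitz step is applied with the smaller of `y` and `z`, which is at most `√y √z`. The
error thereby factorizes and needs only half a power of each variable. -/
lemma transform_tail_max_le_symm (h : IsBlockLaw a κ F₀) (hγ : 0 < γ)
    (hF : IsExpTransform γ F₀ F) {x y z : ℝ} (hx : 0 ≤ x) (hy : 0 ≤ y) (hz : 0 ≤ z) :
    tail F (max (x / 3) (x - (y + z))) ≤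
      ENNReal.ofReal (Real.exp (γ * z)) * tail F (x - y) +
        ENNReal.ofReal (Real.exp (γ * y)) * tail F (x - z) +
        (ENNReal.ofReal √y * ENNReal.ofReal (Real.exp (γ * y))) *
          (ENNReal.ofReal √z * ENNReal.ofReal (Real.exp (γ * z))) * tail F x := by
  have hE : (ENNReal.ofReal √y * ENNReal.ofReal (Real.exp (γ * y))) *
      (ENNReal.ofReal √z * ENNReal.ofReal (Real.exp (γ * z))) =
      ENNReal.ofReal (√y * √z) * ENNReal.ofReal (Real.exp (γ * (y + z))) := by
    rw [mul_add, Real.exp_add, ENNReal.ofReal_mul (by positivity), ENNReal.ofReal_mul (by positivity)]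
    ring
  rw [hE]
  rcases le_total z y with hzy | hzy
  · refine (h.transform_tail_max_le hγ hF hx hz).trans ?_
    refine add_le_add le_self_add ?_
    gcongr
    calc z = √z * √z := (Real.mul_self_sqrt hz).symm
      _ ≤ √y * √z := by gcongr
  · rw [add_comm y z]
    refine (h.transform_tail_max_le hγ hF hx hy).trans ?_
    refine add_le_add le_add_self ?_
    gcongr
    calc y = √y * √y := (Real.mul_self_sqrt hy).symm
      _ ≤ √y * √z := by gcongr

/-- Of three independent summands with sum above `x`, one exceeds `x / 3`. Integrating the symmetric
bound over the other two leaves multiples of the tails of `F^{*2}` and `F`. -/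
lemma transform_absorb (h : IsBlockLaw a κ F₀) (hγ : 0 < γ) (hF : IsExpTransform γ F₀ F)
    (hm : ∫⁻ y, ENNReal.ofReal (y * √y) ∂F₀ ≠ ⊤) :
    ∃ K : ℝ≥0∞, K ≠ ⊤ ∧ ∀ x, tail (convPow F 3) x ≤ K * tail (convPow F 2) x := by
  have := hF.1
  have hF0 := h.transform_Iio_zero hF
  set m := expMoment γ F with hm_def
  have hmt : m ≠ ⊤ := (h.expMoment_transform_lt_top hγ hF hm).ne
  set q := ∫⁻ y, ENNReal.ofReal √y * ENNReal.ofReal (Real.exp (γ * y)) ∂F with hq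
  have hqt : q ≠ ⊤ := h.sqrt_moment_ne_top hγ hF hm
  refine ⟨3 * (m + m + q * q) + 1, by simp [ENNReal.mul_eq_top, hmt, hqt], fun x => ?_⟩
  rw [add_mul, one_mul]
  rcases lt_or_ge x 0 with hx | hx
  · refine le_add_left ?_
    rw [tail_of_neg (convPow_Iio_zero hF0 2) hx]
    exact tail_le_one _ _
  refine le_add_right ?_
  set T := ∫⁻ u, ∫⁻ y, tail F (max (x / 3) (x - (u + y))) ∂F ∂F with hT
  have hT1 : tail (convPow F 3) x ≤ T + 2 * T := by
    have h3 : convPow F 3 = F.conv (F.conv F) := by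
      rw [convPow_add F 1 2, convPow_one, convPow_two]
    rw [h3]
    -- Either the first summand exceeds `x / 3`, or the other two together exceed `2x / 3` and
    -- halving again finds a large one. This gives `T + 2 * T`.
    refine (tail_conv_le_add F (F.conv F) (c := x / 3) (d := 2 * x / 3) (by linarith)).trans ?_
    refine add_le_add ?_ ?_
    · rw [Measure.lintegral_conv (by fun_prop)]
    · rw [hT, ← lintegral_const_mul _ (Measurable.lintegral_prod_right (by fun_prop))]
      refine lintegral_mono fun u => (tail_conv_self_le F _).trans ?_
      refine mul_le_mul' le_rfl (lintegral_mono fun y => tail_antitone F ?_)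
      refine max_le ((le_trans ?_ (le_max_left _ _))) (le_trans ?_ (le_max_right _ _))
      · linarith [le_max_left (2 * x / 3) (x - u)]
      · linarith [le_max_right (2 * x / 3) (x - u)]
  have hT2 : T ≤ (m + m) * tail (convPow F 2) x + q * q * tail F x := by
    have hin : ∀ᵐ y ∂F, ∫⁻ z, tail F (max (x / 3) (x - (y + z))) ∂F ≤
        m * tail F (x - y) + ENNReal.ofReal (Real.exp (γ * y)) * tail (convPow F 2) x +
          (ENNReal.ofReal √y * ENNReal.ofReal (Real.exp (γ * y))) * q * tail F x := by
      filter_upwards [ae_nonneg_of_Iio hF0] with y hy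
      calc ∫⁻ z, tail F (max (x / 3) (x - (y + z))) ∂F ≤
          ∫⁻ z, (ENNReal.ofReal (Real.exp (γ * z)) * tail F (x - y) +
            ENNReal.ofReal (Real.exp (γ * y)) * tail F (x - z) +
            (ENNReal.ofReal √y * ENNReal.ofReal (Real.exp (γ * y))) *
              (ENNReal.ofReal √z * ENNReal.ofReal (Real.exp (γ * z))) * tail F x) ∂F := by
            refine lintegral_mono_ae ?_
            filter_upwards [ae_nonneg_of_Iio hF0] with z hz
            exact h.transform_tail_max_le_symm hγ hF hx hy hz
        _ = _ := by
            rw [lintegral_add_left (by fun_prop), lintegral_add_left (by fun_prop),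
              lintegral_mul_const _ (by fun_prop), lintegral_const_mul _ (by fun_prop),
              lintegral_mul_const _ (by fun_prop), lintegral_const_mul _ (by fun_prop),
              convPow_two, tail_conv, hm_def, expMoment_eq_lintegral hF0]
    calc T ≤ ∫⁻ y, (m * tail F (x - y)
          + ENNReal.ofReal (Real.exp (γ * y)) * tail (convPow F 2) x +
          (ENNReal.ofReal √y * ENNReal.ofReal (Real.exp (γ * y))) * q * tail F x) ∂F :=
          lintegral_mono_ae hin
      _ = m * tail (convPow F 2) x + m * tail (convPow F 2) x + q * q * tail F x := by
          rw [lintegral_add_left (by fun_prop), lintegral_add_left (by fun_prop),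
            lintegral_mul_const _ (by fun_prop), lintegral_const_mul _ (by fun_prop),
            lintegral_mul_const _ (by fun_prop), lintegral_mul_const _ (by fun_prop),
            convPow_two, tail_conv, hm_def, expMoment_eq_lintegral hF0]
      _ = _ := by ring
  calc tail (convPow F 3) x ≤ T + 2 * T := hT1
    _ = 3 * T := by ring
    _ ≤ 3 * ((m + m) * tail (convPow F 2) x + q * q * tail (convPow F 2) x) := by
        gcongr
        refine hT2.trans ?_
        gcongr
        exact tail_le_tail_convPow hF0 (by norm_num) x
    _ = _ := by ring

lemma transform_shift (h : IsBlockLaw a κ F₀) (hF : IsExpTransform γ F₀ F) {t : ℝ} (ht : 0 < t) :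
    ∃ K : ℝ≥0∞, K ≠ ⊤ ∧ ∀ x, tail F (x - t) ≤ K * tail F x := by
  have := hF.1
  have hpos := h.transform_tail_pos hF (3 * t / 2)
  -- The threshold `3t / 2` is where `x - t ≥ x / 3` begins, so that the Lipschitz bound applies;
  -- the added reciprocal handles smaller `x`.
  refine ⟨ENNReal.ofReal (Real.exp (γ * t)) * (1 + ENNReal.ofReal t) + (tail F (3 * t / 2))⁻¹,
    by simp [ENNReal.mul_eq_top, hpos.ne'], fun x => ?_⟩
  rw [add_mul]
  rcases le_total x (3 * t / 2) with hx | hx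
  · refine le_add_left ((tail_le_one F _).trans ?_)
    calc 1 = (tail F (3 * t / 2))⁻¹ * tail F (3 * t / 2) :=
          (ENNReal.inv_mul_cancel hpos.ne' (tail_ne_top _ _)).symm
      _ ≤ _ := by gcongr; exact tail_antitone F hx
  · refine le_add_right ?_
    rw [hF.tail_sub (by linarith), hF.tail_eq (by linarith)]
    have hKI := h.tail_le_tail_add (x := x) (y := x - t) (s := t) (by linarith) ht.le
    rw [sub_add_cancel] at hKI
    calc _ ≤ ENNReal.ofReal (Real.exp (γ * t)) * (ENNReal.ofReal (Real.exp (-γ * x)) *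
          (tail F₀ x + ENNReal.ofReal t * tail F₀ x)) := by gcongr
      _ = _ := by ring

lemma setLIntegral_le_lintegral_transform (h : IsBlockLaw a κ F₀) (hγ : 0 < γ)
    (hF : IsExpTransform γ F₀ F) {s : Set ℝ} (hs0 : s ⊆ Ioi 0) {f : ℝ → ℝ≥0∞}
    (hf : Measurable f) :
    ∫⁻ y in s, ENNReal.ofReal (γ * Real.exp (-γ * y)) * tail F₀ y * f y ≤ ∫⁻ y, f y ∂F := by
  have := h.prob
  rw [hF.eq hγ (measure_mono_null (Iic_subset_Iic.2 zero_le_one) h.Iic_one),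
    lintegral_expTransform hf]
  exact le_add_right (lintegral_mono_set hs0)

/-- On the `n`-th block, the tail of `F^{*2}` is at least of the order of the density of `F₀`
times `κ n * a n ^ 3`. -/
lemma le_transform_conv (h : IsBlockLaw a κ F₀) (hγ : 0 < γ) (hF : IsExpTransform γ F₀ F)
    {n : ℕ} {t x : ℝ} (hn : 8 * t ≤ a n) (hx1 : a n ≤ x) (hx2 : x ≤ 2 * a n + t) :
    ENNReal.ofReal (Real.exp (-γ * x)) *
      (ENNReal.ofReal (κ n) * ENNReal.ofReal (γ / 32 * (κ n * a n ^ 3))) ≤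
        tail (convPow F 2) x := by
  have := hF.1
  have ha := h.one_le n
  have hκ := h.density_pos n
  rw [convPow_two, tail_conv]
  -- For `y` in this window all of block `n` lies beyond `y`, and `8 t ≤ a n` gives `x - y ≤ 2 a n -
  -- a n / 8`, so an eighth of the block lies beyond `x - y`. The window length `a n / 4` supplies
  -- the remaining factor of `1/32`.
  refine le_trans ?_ (h.setLIntegral_le_lintegral_transform hγ hF (s := Ioo (a n / 4) (a n / 2))
    (fun y hy => by have := hy.1; rw [mem_Ioi]; linarith) (by fun_prop))
  have hbound : ∀ y ∈ Ioo (a n / 4) (a n / 2),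
      ENNReal.ofReal (γ * Real.exp (-γ * x) * (κ n * a n) * (κ n * (a n / 8))) ≤
        ENNReal.ofReal (γ * Real.exp (-γ * y)) * tail F₀ y * tail F (x - y) := by
    rintro y ⟨hy1, hy2⟩
    have e1 : ENNReal.ofReal (κ n * a n) ≤ tail F₀ y := by
      have := h.le_tail_of_block (n := n) le_rfl (by linarith) le_rfl
      rw [ENNReal.ofReal_mul hκ.le]
      rw [two_mul, add_sub_cancel_right] at this
      exact (le_add_self.trans this).trans (tail_antitone F₀ (by linarith))
    have e2 : ENNReal.ofReal (κ n * (a n / 8)) ≤ tail F₀ (x - y) := by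
      have := h.le_tail_of_block (n := n) (u := 2 * a n - a n / 8) (by linarith) (by linarith)
        le_rfl
      rw [ENNReal.ofReal_mul hκ.le]
      rw [sub_sub_cancel] at this
      exact (le_add_self.trans this).trans (tail_antitone F₀ (by linarith))
    rw [hF.tail_eq (by linarith)]
    calc ENNReal.ofReal (γ * Real.exp (-γ * x) * (κ n * a n) * (κ n * (a n / 8)))
        = ENNReal.ofReal (γ * Real.exp (-γ * y)) * ENNReal.ofReal (κ n * a n) *
          (ENNReal.ofReal (Real.exp (-γ * (x - y))) * ENNReal.ofReal (κ n * (a n / 8))) := by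
          rw [← ENNReal.ofReal_mul (by positivity), ← ENNReal.ofReal_mul (by positivity),
            ← ENNReal.ofReal_mul (by positivity)]
          congr 1
          rw [show -γ * x = -γ * y + -γ * (x - y) by ring, Real.exp_add]
          ring
      _ ≤ _ := by gcongr
  calc _ = ENNReal.ofReal (γ * Real.exp (-γ * x) * (κ n * a n) * (κ n * (a n / 8))) *
        volume (Ioo (a n / 4) (a n / 2)) := by
        rw [Real.volume_Ioo, ← ENNReal.ofReal_mul (by positivity),
          ← ENNReal.ofReal_mul (by positivity), ← ENNReal.ofReal_mul (by positivity)]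
        congr 1
        ring
    _ = ∫⁻ _ in Ioo (a n / 4) (a n / 2),
        ENNReal.ofReal (γ * Real.exp (-γ * x) * (κ n * a n) * (κ n * (a n / 8))) := by
        rw [setLIntegral_const]
    _ ≤ _ := setLIntegral_mono' measurableSet_Ioo hbound

/-- The defect is at most a constant times `e^{-γ x} κ n`. Before block `n` the tail of `F` itself
is larger by a factor `a n`; from `a n` on, `F^{*2}` wins by a factor of order `κ n * a n ^ 3`. -/
lemma transform_shiftNegl (h : IsBlockLaw a κ F₀) (hγ : 0 < γ) (hF : IsExpTransform γ F₀ F)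
    (hg : Tendsto (fun n => κ n * a n ^ 3) atTop atTop) :
    ShiftNegl γ (tail (convPow F 2)) F := by
  have := hF.1
  have hF0 := h.transform_Iio_zero hF
  intro t ht ε hε
  set E := ENNReal.ofReal (Real.exp (γ * t)) with hE
  obtain ⟨δ, hδ0, hδ2, hδ⟩ := exists_ne_zero_mul_le (C := 1) (by simp) hε
  rw [mul_one] at hδ
  have hδt : δ ≠ ⊤ := ne_top_of_le_ne_top (by simp) hδ2
  set e := δ.toReal with he
  have he0 : 0 < e := ENNReal.toReal_pos hδ0 hδt
  have heδ : ENNReal.ofReal e ≤ ε := by rwa [he, ENNReal.ofReal_toReal hδt]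
  obtain ⟨N, hN⟩ := eventually_atTop.1 ((h.tendsto.eventually_ge_atTop (8 * t)).and
    ((h.tendsto.eventually_ge_atTop (Real.exp (γ * t) * t / e)).and
      (hg.eventually_ge_atTop (Real.exp (γ * t) * t / e * 32 / γ))))
  filter_upwards [eventually_gt_atTop (2 * a N + t), eventually_ge_atTop t] with x hxN hxt
  refine ⟨?_, (hF.exp_mul_tail_le ht.le hxt).trans le_self_add⟩
  obtain ⟨n, hn1, hn2⟩ : ∃ n, x ≤ 2 * a n + t ∧ ∀ i < n, 2 * a i + t < x := by
    have hex : ∃ n, x ≤ 2 * a n + t := by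
      obtain ⟨n, hn⟩ := (h.tendsto.eventually_ge_atTop x).exists
      exact ⟨n, by linarith [h.one_le n]⟩
    classical
    exact ⟨Nat.find hex, Nat.find_spec hex, fun i hi => not_le.1 (Nat.find_min hex hi)⟩
  have hNn : N ≤ n := by
    by_contra hlt
    linarith [h.strictMono.monotone (not_le.1 hlt).le]
  obtain ⟨c1, c2, c3⟩ := hN n hNn
  have hκ := h.density_pos n
  have hlip := h.tail_le_add (n := n) (u := x - t) (v := x) (by linarith) fun i hi => by
    linarith [hn2 i hi]
  rw [sub_sub_cancel] at hlip
  have hmain : E * (ENNReal.ofReal (Real.exp (-γ * x)) *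
      (ENNReal.ofReal (κ n) * ENNReal.ofReal t)) ≤ ENNReal.ofReal e * tail (convPow F 2) x := by
    -- Here `b` is the gain over `e^{-γ x} κ n`; only its divergence matters, so the two ranges of
    -- `x` share this reduction.
    have hred : ∀ b : ℝ, 0 ≤ b → Real.exp (γ * t) * t / e ≤ b →
        ENNReal.ofReal (Real.exp (-γ * x)) * (ENNReal.ofReal (κ n) * ENNReal.ofReal b) ≤
          tail (convPow F 2) x →
        E * (ENNReal.ofReal (Real.exp (-γ * x)) *
          (ENNReal.ofReal (κ n) * ENNReal.ofReal t)) ≤ ENNReal.ofReal e * tail (convPow F 2) x := by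
      intro b hb0 hb hle
      calc E * (ENNReal.ofReal (Real.exp (-γ * x)) * (ENNReal.ofReal (κ n) * ENNReal.ofReal t))
          = ENNReal.ofReal (Real.exp (-γ * x)) * (ENNReal.ofReal (κ n) *
            ENNReal.ofReal (Real.exp (γ * t) * t)) := by
            rw [ENNReal.ofReal_mul (Real.exp_pos _).le]; ring
        _ ≤ ENNReal.ofReal (Real.exp (-γ * x)) * (ENNReal.ofReal (κ n) *
            ENNReal.ofReal (e * b)) := by
            rw [div_le_iff₀' he0] at hb
            exact mul_le_mul' le_rfl (mul_le_mul' le_rfl (ENNReal.ofReal_le_ofReal hb))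
        _ = ENNReal.ofReal e * (ENNReal.ofReal (Real.exp (-γ * x)) *
            (ENNReal.ofReal (κ n) * ENNReal.ofReal b)) := by
            rw [ENNReal.ofReal_mul he0.le]; ring
        _ ≤ _ := by gcongr
    rcases le_total x (a n) with hx | hx
    · refine hred (a n) (by linarith [h.one_le n]) c2 ?_
      refine le_trans ?_ (tail_le_tail_convPow hF0 (by norm_num) x)
      rw [hF.tail_eq (by linarith)]
      gcongr
      have := h.le_tail_of_block (n := n) le_rfl (by linarith [h.one_le n]) le_rfl
      rw [two_mul, add_sub_cancel_right] at this
      exact (le_add_self.trans this).trans (tail_antitone F₀ hx)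
    · have ha := h.one_le n
      refine hred (γ / 32 * (κ n * a n ^ 3)) (by positivity) ?_
        (h.le_transform_conv hγ hF c1 hx hn1)
      rw [div_le_iff₀ hγ] at c3
      linarith
  calc tail F (x - t) = E * (ENNReal.ofReal (Real.exp (-γ * x)) * tail F₀ (x - t)) :=
        hF.tail_sub hxt
    _ ≤ E * (ENNReal.ofReal (Real.exp (-γ * x)) *
        (tail F₀ x + ENNReal.ofReal (κ n) * ENNReal.ofReal t)) := by gcongr
    _ = E * tail F x + E * (ENNReal.ofReal (Real.exp (-γ * x)) *
        (ENNReal.ofReal (κ n) * ENNReal.ofReal t)) := by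
        rw [hF.tail_eq (ht.le.trans hxt)]; ring
    _ ≤ E * tail F x + ENNReal.ofReal e * tail (convPow F 2) x := by gcongr
    _ ≤ _ := by gcongr

/-- At the right end points of the blocks, the tail of the transform is not regular. -/
lemma le_transform_tail_sub_one (h : IsBlockLaw a κ F₀) (hF : IsExpTransform γ F₀ F) (n : ℕ) :
    ENNReal.ofReal (Real.exp (γ * 1)) * (tail F (2 * a n) + 2⁻¹ * tail F (2 * a n)) ≤
      tail F (2 * a n - 1) := by
  have ha := h.one_le n
  rw [hF.tail_sub (by linarith), hF.tail_eq (by linarith)]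
  gcongr
  rw [mul_left_comm 2⁻¹, ← mul_add]
  gcongr
  have h1 := h.le_tail_of_block (n := n) (u := 2 * a n - 1) (by linarith) (by linarith) le_rfl
  rw [sub_sub_cancel, ENNReal.ofReal_one, mul_one] at h1
  refine le_trans ?_ h1
  gcongr
  calc 2⁻¹ * tail F₀ (2 * a n) ≤ 2⁻¹ * (2 * ENNReal.ofReal (κ n)) := by
        gcongr; exact h.tail_two_mul_le n
    _ = _ := by rw [← mul_assoc, ENNReal.inv_mul_cancel (by simp) (by simp), one_mul]

/-- At `2 a n` the shift defect is at least a fixed proportion of `tail F`, yet it is negligible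
against `F^{*2}`; hence so is `tail F`. -/
lemma transform_sparse (h : IsBlockLaw a κ F₀) (hγ : 0 < γ) (hF : IsExpTransform γ F₀ F)
    (hg : Tendsto (fun n => κ n * a n ^ 3) atTop atTop) {ε : ℝ≥0∞} (hε : ε ≠ 0) :
    ∀ᶠ n in atTop, tail F (2 * a n) ≤ ε * tail (convPow F 2) (2 * a n) := by
  have := hF.1
  obtain ⟨δ, hδ0, -, hδ⟩ := exists_ne_zero_mul_le (C := 2) (by simp) hε
  have hu : Tendsto (fun n => 2 * a n) atTop atTop := h.tendsto.const_mul_atTop (by norm_num)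
  filter_upwards [hu.eventually (h.transform_shiftNegl hγ hF hg 1 one_pos δ hδ0)] with n hn
  set E := ENNReal.ofReal (Real.exp (γ * 1)) with hE
  have hE1 : 1 ≤ E := by
    rw [hE, ENNReal.one_le_ofReal, Real.one_le_exp_iff]; linarith
  have h1 := (h.le_transform_tail_sub_one hF n).trans hn.1
  rw [mul_add, ENNReal.add_le_add_iff_left
    (ENNReal.mul_ne_top ENNReal.ofReal_ne_top (tail_ne_top _ _))] at h1
  calc tail F (2 * a n) = 2 * (1 * (2⁻¹ * tail F (2 * a n))) := by
        rw [one_mul, ← mul_assoc, ENNReal.mul_inv_cancel (by simp) (by simp), one_mul]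
    _ ≤ 2 * (E * (2⁻¹ * tail F (2 * a n))) := by gcongr
    _ ≤ 2 * (δ * tail (convPow F 2) (2 * a n)) := by gcongr
    _ = δ * 2 * tail (convPow F 2) (2 * a n) := by ring
    _ ≤ _ := by gcongr

theorem transform_absorbsConv (h : IsBlockLaw a κ F₀) (hγ : 0 < γ) (hF : IsExpTransform γ F₀ F)
    (hm : ∫⁻ y, ENNReal.ofReal (y * √y) ∂F₀ ≠ ⊤)
    (hg : Tendsto (fun n => κ n * a n ^ 3) atTop atTop) : AbsorbsConv γ F where
  prob := hF.1
  nonneg := h.transform_Iio_zero hF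
  tail_pos := h.transform_tail_pos hF
  moment := h.expMoment_transform_lt_top hγ hF hm
  absorb := h.transform_absorb hγ hF hm
  shift _ ht := h.transform_shift hF ht
  negl := h.transform_shiftNegl hγ hF hg
  sparse := ⟨fun n => 2 * a n, h.tendsto.const_mul_atTop (by norm_num),
    fun _ hε => h.transform_sparse hγ hF hg hε⟩

theorem transform_mem (h : IsBlockLaw a κ F₀) (hγ : 0 < γ) (hF : IsExpTransform γ F₀ F)
    (hg : Tendsto (fun n => κ n * a n ^ 3) atTop atTop) :
    F ∈ classOL \ (classL γ ∪ classOS) := by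
  have := hF.1
  have hF0 := h.transform_Iio_zero hF
  have hpos := h.transform_tail_pos hF
  have hu : Tendsto (fun n => 2 * a n) atTop atTop := h.tendsto.const_mul_atTop (by norm_num)
  refine ⟨⟨⟨⟨hF.1, hF0⟩, hpos⟩, fun t ht => ?_⟩, ?_⟩
  · rcases lt_or_gt_of_ne ht with ht | ht
    · refine lt_of_le_of_lt (limsup_le_of_le (a := 1) (by isBoundedDefault)
        (Eventually.of_forall fun x => ?_)) ENNReal.one_lt_top
      exact ENNReal.div_le_of_le_mul (by
        rw [one_mul]; exact tail_antitone F (by linarith))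
    · obtain ⟨K, hK, hKt⟩ := h.transform_shift hF ht
      exact lt_of_le_of_lt (limsup_le_of_le (a := K) (by isBoundedDefault)
        (Eventually.of_forall fun x => ENNReal.div_le_of_le_mul (hKt x))) hK.lt_top
  · rintro (hL | hOS)
    · have hlim := ge_of_tendsto ((hL.2 1).comp hu) (b := ENNReal.ofReal (Real.exp (γ * 1)) *
        (1 + 2⁻¹)) (Eventually.of_forall fun n => by
          rw [Function.comp_apply,
            ENNReal.le_div_iff_mul_le (.inl (hpos _).ne') (.inl (tail_ne_top _ _))]
          refine le_of_eq_of_le ?_ (h.le_transform_tail_sub_one hF n)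
          ring)
      have hE0 : ENNReal.ofReal (Real.exp (γ * 1)) ≠ 0 := by simp [Real.exp_pos]
      have hEt : ENNReal.ofReal (Real.exp (γ * 1)) ≠ ⊤ := ENNReal.ofReal_ne_top
      have h1 : (1 : ℝ≥0∞) + 2⁻¹ ≤ 1 + 0 := by
        rw [add_zero]
        refine (ENNReal.mul_le_mul_iff_right hE0 hEt).1 ?_
        simpa only [mul_one] using hlim
      simpa using (ENNReal.add_le_add_iff_left ENNReal.one_ne_top).1 h1
    · obtain ⟨c, hc1, hc2⟩ := exists_between hOS.2
      obtain ⟨ε, hε0, -, hε⟩ := exists_ne_zero_mul_le (C := c) hc2.ne (ε := 2⁻¹) (by simp)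
      obtain ⟨n, hn1, hn2⟩ := ((hu.eventually (eventually_lt_of_limsup_lt hc1)).and
        (h.transform_sparse hγ hF hg hε0)).exists
      have h0 := hpos (2 * a n)
      have h1 := tail_ne_top F (2 * a n)
      have h2 : tail (convPow F 2) (2 * a n) ≤ c * tail F (2 * a n) :=
        (ENNReal.div_le_iff h0.ne' h1).1 hn1.le
      have h3 : tail F (2 * a n) ≤ 0 + 2⁻¹ * tail F (2 * a n) := by
        calc tail F (2 * a n) ≤ ε * (c * tail F (2 * a n)) := hn2.trans (by gcongr)
          _ = ε * c * tail F (2 * a n) := by ring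
          _ ≤ 2⁻¹ * tail F (2 * a n) := by gcongr
          _ = _ := by rw [zero_add]
      have h4 := le_two_mul_of_le_add_half h1 h3
      rw [mul_zero] at h4
      exact h0.not_ge h4

/-- The gap before block `n` makes the tail of `F₀` constant from `a n / 2` to `a n`. Moving the
level there changes `tail F` by the exponential factor only, so at `a n` the tail of `F^{*2}` is at
most `2 m(F) tail F`. -/
theorem transform_not_isLittleO (h : IsBlockLaw a κ F₀) (hγ : 0 < γ)
    (hF : IsExpTransform γ F₀ F) (hm : ∫⁻ y, ENNReal.ofReal (y * √y) ∂F₀ ≠ ⊤) :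
    ¬ Tendsto (fun x => tail F x / tail (convPow F 2) x) atTop (𝓝 0) := by
  have := hF.1
  have hF0 := h.transform_Iio_zero hF
  have hpos := h.transform_tail_pos hF
  intro hlim
  have hmt := (h.expMoment_transform_lt_top hγ hF hm).ne
  have hbound : ∀ n, (2 * expMoment γ F)⁻¹ ≤ tail F (a n) / tail (convPow F 2) (a n) := fun n => by
    have ha := h.one_le n
    have h0 := ((hpos (a n)).trans_le (tail_le_tail_convPow hF0 (k := 2) (by norm_num) (a n))).ne'
    rw [ENNReal.le_div_iff_mul_le (.inl h0) (.inl (tail_ne_top _ _)), mul_comm, ← div_eq_mul_inv]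
    refine ENNReal.div_le_of_le_mul' ?_
    rw [convPow_two, mul_assoc]
    refine (tail_conv_self_le F (a n)).trans (mul_le_mul' le_rfl ?_)
    rw [expMoment_eq_lintegral hF0, ← lintegral_mul_const _ (by fun_prop)]
    refine lintegral_mono fun y => ?_
    have h1 := le_max_left (a n / 2) (a n - y)
    have h2 := le_max_right (a n / 2) (a n - y)
    rw [hF.tail_eq (by linarith), hF.tail_eq (by linarith), ← mul_assoc,
      ← ENNReal.ofReal_mul (by positivity), ← Real.exp_add]
    refine mul_le_mul' (ENNReal.ofReal_le_ofReal (Real.exp_le_exp.2 (by nlinarith))) ?_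
    rw [← h.tail_half]
    exact tail_antitone F₀ h1
  have h1 := ge_of_tendsto' (hlim.comp h.tendsto) hbound
  have h2 := ENNReal.inv_eq_zero.1 (le_zero_iff.1 h1)
  exact ENNReal.mul_ne_top (by simp) hmt h2

end IsBlockLaw

/-! ### The laws of `η (1 + U)` -/

lemma map_mul_one_add_restrict {b : ℝ} (hb : 0 < b) :
    (volume.restrict (Ioo (0 : ℝ) 1)).map (fun u => b * (1 + u)) =
      ENNReal.ofReal b⁻¹ • volume.restrict (Ioo b (2 * b)) := by
  refine Measure.ext fun s hs => ?_
  rw [Measure.map_apply (by fun_prop) hs, Measure.restrict_apply (hs.preimage (by fun_prop)),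
    Measure.smul_apply, Measure.restrict_apply hs, smul_eq_mul]
  have h1 : (fun u => b * (1 + u)) ⁻¹' s ∩ Ioo 0 1 =
      (fun u => 1 + u) ⁻¹' ((fun u => b * u) ⁻¹' (s ∩ Ioo b (2 * b))) := by
    ext u
    simp only [mem_inter_iff, mem_preimage, mem_Ioo]
    refine and_congr_right fun _ => and_congr ?_ ?_ <;> constructor <;> intro h <;> nlinarith
  rw [h1, measure_preimage_add, Real.volume_preimage_mul_left hb.ne', abs_of_pos (by positivity)]

section EtaPoint

variable {α a : ℝ}

lemma etaPoint_succ (ha : 1 < a) (n : ℕ) :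
    etaPoint α a (n + 1) = etaPoint α a n ^ (1 + 1 / α) := by
  rw [etaPoint, etaPoint, ← Real.rpow_mul (by linarith), pow_succ]

lemma le_etaPoint (hα : 0 < α) (ha : 1 < a) (n : ℕ) : a ≤ etaPoint α a n := by
  rw [etaPoint]
  refine Real.self_le_rpow_of_one_le ha.le (one_le_pow₀ ?_)
  have : 0 < 1 / α := by positivity
  linarith

lemma etaPoint_pos (ha : 1 < a) (n : ℕ) : 0 < etaPoint α a n :=
  Real.rpow_pos_of_pos (by linarith) _

/-- The ratio of consecutive points is the power `1 / α` of the smaller one, hence at least its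
initial value `a ^ (1 / α) > 8`. -/
lemma eight_mul_etaPoint_lt (hα : 0 < α) (ha : 1 < a) (h8 : 8 * a < a ^ (1 + 1 / α)) (n : ℕ) :
    8 * etaPoint α a n < etaPoint α a (n + 1) := by
  have hpos := etaPoint_pos (α := α) ha n
  rw [etaPoint_succ ha, Real.rpow_add hpos, Real.rpow_one]
  rw [Real.rpow_add (by linarith), Real.rpow_one] at h8
  have h1 : a ^ (1 / α) ≤ etaPoint α a n ^ (1 / α) :=
    Real.rpow_le_rpow (by linarith) (le_etaPoint hα ha n) (by positivity)
  have h2 : 8 < a ^ (1 / α) := by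
    by_contra hle
    nlinarith [not_lt.1 hle]
  nlinarith

lemma eight_pow_le_etaPoint (hα : 0 < α) (ha : 1 < a) (h8 : 8 * a < a ^ (1 + 1 / α)) (n : ℕ) :
    (8 : ℝ) ^ n ≤ etaPoint α a n := by
  induction n with
  | zero => simpa using ha.le.trans (le_etaPoint hα ha 0)
  | succ n ih => rw [pow_succ]; linarith [eight_mul_etaPoint_lt hα ha h8 n]

lemma summable_etaPoint_rpow (hα : 0 < α) (ha : 1 < a) (h8 : 8 * a < a ^ (1 + 1 / α)) {s : ℝ}
    (hs : s < 0) : Summable fun n => etaPoint α a n ^ s := by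
  have hg : Summable fun n : ℕ => ((8 : ℝ) ^ s) ^ n :=
    summable_geometric_of_lt_one (by positivity) (Real.rpow_lt_one_of_one_lt_of_neg (by norm_num) hs)
  refine Summable.of_nonneg_of_le (fun n => (Real.rpow_pos_of_pos (etaPoint_pos ha n) _).le)
    (fun n => ?_) hg
  rw [← Real.rpow_natCast, ← Real.rpow_mul (by norm_num), mul_comm, Real.rpow_mul (by norm_num),
    Real.rpow_natCast]
  exact Real.rpow_le_rpow_of_nonpos (by positivity) (eight_pow_le_etaPoint hα ha h8 n) hs.le

/-- The density of the law of `η (1 + U)` on its `n`-th block. -/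
noncomputable def xiDensity (α a : ℝ) (n : ℕ) : ℝ :=
  (∑' i : ℕ, etaPoint α a i ^ (-α))⁻¹ * etaPoint α a n ^ (-α) * (etaPoint α a n)⁻¹

lemma etaNorm_pos (hα : 0 < α) (ha : 1 < a) (h8 : 8 * a < a ^ (1 + 1 / α)) :
    0 < ∑' i : ℕ, etaPoint α a i ^ (-α) :=
  (summable_etaPoint_rpow hα ha h8 (neg_lt_zero.2 hα)).tsum_pos
    (fun n => (Real.rpow_pos_of_pos (etaPoint_pos ha n) _).le) 0
    (Real.rpow_pos_of_pos (etaPoint_pos ha 0) _)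

lemma xiLaw_eq_sum (hα : 0 < α) (ha : 1 < a) (h8 : 8 * a < a ^ (1 + 1 / α)) :
    xiLaw α a = Measure.sum fun n => ENNReal.ofReal (xiDensity α a n) •
      volume.restrict (Ioo (etaPoint α a n) (2 * etaPoint α a n)) := by
  have hf : Measurable fun p : ℝ × ℝ => p.1 * (1 + p.2) := by fun_prop
  rw [xiLaw, etaLaw, Measure.prod_sum_left, Measure.map_sum hf.aemeasurable]
  congr 1
  funext n
  have hC := etaNorm_pos hα ha h8
  have hpos := etaPoint_pos (α := α) ha n
  have hcomp : (fun p : ℝ × ℝ => p.1 * (1 + p.2)) ∘ Prod.mk (etaPoint α a n) =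
      fun u => etaPoint α a n * (1 + u) := rfl
  rw [Measure.prod_smul_left, Measure.map_smul, Measure.dirac_prod,
    Measure.map_map hf (by fun_prop), hcomp, map_mul_one_add_restrict hpos, smul_smul,
    ← ENNReal.ofReal_mul (by positivity), xiDensity]

lemma isProbabilityMeasure_xiLaw (hα : 0 < α) (ha : 1 < a) (h8 : 8 * a < a ^ (1 + 1 / α)) :
    IsProbabilityMeasure (xiLaw α a) := by
  have hC := etaNorm_pos hα ha h8
  constructor
  rw [xiLaw_eq_sum hα ha h8, Measure.sum_apply _ MeasurableSet.univ]
  have h1 : ∀ n, (ENNReal.ofReal (xiDensity α a n) •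
      volume.restrict (Ioo (etaPoint α a n) (2 * etaPoint α a n))) univ =
      ENNReal.ofReal ((∑' i : ℕ, etaPoint α a i ^ (-α))⁻¹ * etaPoint α a n ^ (-α)) := fun n => by
    have hpos := etaPoint_pos (α := α) ha n
    rw [Measure.smul_apply, Measure.restrict_apply_univ, Real.volume_Ioo, smul_eq_mul,
      ← ENNReal.ofReal_mul (by unfold xiDensity; positivity), two_mul, add_sub_cancel_right,
      xiDensity, inv_mul_cancel_right₀ hpos.ne']
  simp only [h1]
  rw [← ENNReal.ofReal_tsum_of_nonneg (fun n => by
      have hpos := etaPoint_pos (α := α) ha n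
      positivity)
    ((summable_etaPoint_rpow hα ha h8 (neg_lt_zero.2 hα)).mul_left _), tsum_mul_left,
    inv_mul_cancel₀ hC.ne', ENNReal.ofReal_one]

theorem isBlockLaw_xiLaw (hα : 0 < α) (ha : 1 < a) (h8 : 8 * a < a ^ (1 + 1 / α)) :
    IsBlockLaw (etaPoint α a) (xiDensity α a) (xiLaw α a) where
  prob := isProbabilityMeasure_xiLaw hα ha h8
  one_lt := ha.trans_le (le_etaPoint hα ha 0)
  step := eight_mul_etaPoint_lt hα ha h8
  density_pos n := by
    have hC := etaNorm_pos hα ha h8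
    have hpos := etaPoint_pos (α := α) ha n
    unfold xiDensity
    positivity
  density_step n := by
    have hpos := etaPoint_pos (α := α) ha n
    have hpos' := etaPoint_pos (α := α) ha (n + 1)
    rw [xiDensity, xiDensity, inv_mul_cancel_right₀ hpos'.ne', etaPoint_succ ha,
      ← Real.rpow_mul hpos.le, mul_assoc, ← Real.rpow_neg_one (etaPoint α a n),
      ← Real.rpow_add hpos]
    congr 2
    field_simp
    ring
  law := xiLaw_eq_sum hα ha h8

/-- The product is a positive constant times `etaPoint α a n ^ (2 - α)`. -/
lemma tendsto_xiDensity_mul (hα : 0 < α) (hα2 : α < 2) (ha : 1 < a)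
    (h8 : 8 * a < a ^ (1 + 1 / α)) :
    Tendsto (fun n => xiDensity α a n * etaPoint α a n ^ 3) atTop atTop := by
  have hC := etaNorm_pos hα ha h8
  refine (((tendsto_rpow_atTop (sub_pos.2 hα2)).comp
    (isBlockLaw_xiLaw hα ha h8).tendsto).const_mul_atTop (inv_pos.2 hC)).congr fun n => ?_
  have hpos := etaPoint_pos (α := α) ha n
  rw [Function.comp_apply, xiDensity, sub_eq_neg_add, Real.rpow_add hpos,
    show (2 : ℝ) = (2 : ℕ) by norm_num, Real.rpow_natCast]
  field_simp

/-- Block `n` contributes at most a constant times `etaPoint α a n ^ (3 / 2 - α)`, which is summable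
because the points grow at least geometrically. -/
lemma sesquimoment_xiLaw_ne_top (hα : 3 / 2 < α) (ha : 1 < a) (h8 : 8 * a < a ^ (1 + 1 / α)) :
    ∫⁻ y, ENNReal.ofReal (y * √y) ∂(xiLaw α a) ≠ ⊤ := by
  have hα0 : 0 < α := by linarith
  have hC := etaNorm_pos hα0 ha h8
  set C := (∑' i : ℕ, etaPoint α a i ^ (-α))⁻¹ with hCdef
  have hC0 : 0 < C := inv_pos.2 hC
  have hsum : Summable fun n => 4 * C * etaPoint α a n ^ (-α + 3 / 2) :=
    (summable_etaPoint_rpow hα0 ha h8 (by linarith)).mul_left _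
  rw [xiLaw_eq_sum hα0 ha h8, lintegral_sum_measure]
  refine ne_top_of_le_ne_top hsum.tsum_ofReal_ne_top (ENNReal.tsum_le_tsum fun n => ?_)
  have hpos := etaPoint_pos (α := α) ha n
  set b := etaPoint α a n with hb
  rw [lintegral_smul_measure, smul_eq_mul]
  have hbound : ∫⁻ y in Ioo b (2 * b), ENNReal.ofReal (y * √y) ≤
      ENNReal.ofReal (4 * b ^ (3 / 2 : ℝ)) * ENNReal.ofReal b := by
    calc ∫⁻ y in Ioo b (2 * b), ENNReal.ofReal (y * √y)
        ≤ ∫⁻ _ in Ioo b (2 * b), ENNReal.ofReal (4 * b ^ (3 / 2 : ℝ)) := by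
          refine setLIntegral_mono measurable_const fun y hy => ENNReal.ofReal_le_ofReal ?_
          have h1 : √y ≤ 2 * √b := by
            rw [show 2 * √b = √(4 * b) by
              rw [Real.sqrt_mul (by norm_num), show (4 : ℝ) = 2 ^ 2 by norm_num,
                Real.sqrt_sq (by norm_num)]]
            exact Real.sqrt_le_sqrt (by linarith [hy.2])
          have h2 : b ^ (3 / 2 : ℝ) = b * √b := by
            rw [show (3 / 2 : ℝ) = 1 + 1 / 2 by norm_num, Real.rpow_add hpos, Real.rpow_one,
              Real.sqrt_eq_rpow]
          rw [h2]
          nlinarith [Real.sqrt_nonneg y, Real.sqrt_nonneg b, hy.1, hy.2]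
      _ = _ := by rw [setLIntegral_const, Real.volume_Ioo, two_mul, add_sub_cancel_right]
  calc _ ≤ ENNReal.ofReal (xiDensity α a n) *
        (ENNReal.ofReal (4 * b ^ (3 / 2 : ℝ)) * ENNReal.ofReal b) := by gcongr
    _ = ENNReal.ofReal (4 * C * b ^ (-α + 3 / 2)) := by
        rw [xiDensity, ← ENNReal.ofReal_mul (by positivity), ← ENNReal.ofReal_mul (by positivity),
          Real.rpow_add hpos]
        congr 1
        rw [← hCdef, ← hb]
        field_simp
    _ ≤ _ := le_rfl

end EtaPoint

/-- Here `F ∈ F₃(γ)` is the transform of `F₀ ∈ F₃(0)`. -/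
theorem proposition5p3 (γ : ℝ) (hγ : 0 < γ) (F₀ F : Measure ℝ)
    (hF₀ : F₀ ∈ classF3Zero) (hF : IsExpTransform γ F₀ F) :
    expMoment γ F < ⊤ ∧
    (∀ k : ℕ, 2 ≤ k → convPow F k ∈ (classL γ ∩ classOS) \ classS γ) ∧
    F ∈ classOL \ (classL γ ∪ classOS) ∧
    (∀ k : ℕ, 1 ≤ k → convPow F₀ k ∈ classOS \ classL 0) ∧
    (∀ t : ℝ, 0 < t →
      ENNReal.ofReal (Real.exp (γ * t)) ≤
        liminf (fun x => tail F (x - t) / tail F x) atTop) ∧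
    ¬ Tendsto (fun x => tail F x / tail (convPow F 2) x) atTop (𝓝 0) ∧
    (∀ τ : PMF ℕ, (∃ k : ℕ, 2 ≤ k ∧ τ k ≠ 0) →
      (∀ ε : ℝ, 0 < ε → ε < 1 → ∃ M : ℕ, ∀ x : ℝ, 0 ≤ x →
        ∑' j : ℕ, τ (M + j + 1) * tail (convPow F (M + j)) x ≤
          ENNReal.ofReal ε * tail (randomConv F τ) x) →
      randomConv F τ ∈ (classL γ ∩ classOS) \ classS γ) := by

  obtain ⟨α, a, hα, hα2, ha, h8, rfl⟩ := hF₀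
  have hα0 : 0 < α := by linarith
  -- This bound makes `κ n * a n ^ 3` diverge.
  have hα2 : α < 2 := by
    have : √5 < 3 := (Real.sqrt_lt' (by norm_num)).2 (by norm_num)
    linarith
  have h := isBlockLaw_xiLaw hα0 ha h8
  have hg := tendsto_xiDensity_mul hα0 hα2 ha h8
  have hm := sesquimoment_xiLaw_ne_top hα ha h8
  have hA := h.transform_absorbsConv hγ hF hm hg
  have := hF.1
  refine ⟨hA.moment, fun k hk => hA.convPow_mem hγ.le hk, h.transform_mem hγ hF hg,
    fun k hk => h.convPow_mem (h.mean_ne_top hm) hk, fun t ht => ?_,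
    h.transform_not_isLittleO hγ hF hm, fun τ h2 hτ => hA.randomConv_mem hγ.le h2 hτ⟩
  refine le_liminf_of_le (by isBoundedDefault) ?_
  filter_upwards [eventually_ge_atTop t] with x hx
  rw [ENNReal.le_div_iff_mul_le (.inl (hA.tail_pos x).ne') (.inl (tail_ne_top F x))]
  exact hF.exp_mul_tail_le ht.le hx
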